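/- Let $\mathbf{C}$ be a combinatorial model category (locally presentable, with sets of generating cofibrations and of generating trivial cofibrations) equipped with a biclosed monoidal structure, not assumed symmetric. For $f\colon A\to B$ and $g\colon A'\to B'$ write $f\square g\colon A\otimes B'\amalg_{A\otimes A'}B\otimes A'\to B\otimes B'$ for the pushout-product. Assume that $\mathbf{C}$ is a monoidal model category: the unit is cofibrant, and $f\square g$ is a cofibration whenever $f$ and $g$ are cofibrations, and a trivial cofibration if moreover $f$ or $g$ is a weak equivalence. Assume also that $\mathbf{C}$ satisfies the non-symmetric monoid axiom: if $\mathfrak{U}$ denotes the class of morphisms of the form $f_1\square\cdots\square f_n$ ($n\ge 1$), where each $f_i$ is either a trivial cofibration or of the form $\emptyset\to X_i$ for an arbitrary object $X_i\in\mathbf{C}$, and at least one $f_i$ is a trivial cofibration, then the weakly saturated class generated by $\mathfrak{U}$ (its closure under pushouts, transfinite composition and retracts) is contained in the weak equivalences of $\mathbf{C}$. Let $\mathrm{Alg}(\mathbf{C})$ be the category of (unital) associative algebra objects of $\mathbf{C}$. Then the forgetful functor $U\colon\mathrm{Alg}(\mathbf{C})\to\mathbf{C}$ has a left adjoint $F$,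 and the free associative algebra monad $T=UF$ is combinatorially admissible: the category $\mathrm{Alg}(T)$ of $T$-algebras has a model structure in which a morphism is a weak equivalence or a fibration if and only if its underlying morphism in $\mathbf{C}$ is one; this model structure is combinatorial; and whenever $I$ and $J$ are sets of generating cofibrations and of generating trivial cofibrations of $\mathbf{C}$, the sets $F_T(I)$ and $F_T(J)$ (where $F_T\colon\mathbf{C}\to\mathrm{Alg}(T)$ is the free $T$-algebra functor) are sets of generating cofibrations and of generating trivial cofibrations of $\mathrm{Alg}(T)$. Likewise $\mathrm{Alg}(\mathbf{C})$ carries a combinatorial model structure whose weak equivalences and fibrations are detected by $U$, with $F(I)$ and $F(J)$ as sets of generating cofibrations and trivial cofibrations. -/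

import Mathlib

open CategoryTheory Limits MonoidalCategory HomotopicalAlgebra

universe v u u'

namespace CategoryTheory.MorphismProperty

variable {C : Type u} [Category.{v} C]

/-- A class of morphisms is weakly saturated if it is stable under pushouts,
transfinite compositions (indexed by small well-orders) and retracts. -/
structure IsWeaklySaturated (W : MorphismProperty C) : Prop where
  isStableUnderCobaseChange : W.IsStableUnderCobaseChange
  isStableUnderTransfiniteComposition : IsStableUnderTransfiniteComposition.{v} W
  isStableUnderRetracts : W.IsStableUnderRetracts

/-- The weakly saturated class generated by a class of morphisms `U`: the smallest
weakly saturated class that contains `U`. -/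
def weakSaturation (U : MorphismProperty C) : MorphismProperty C :=
  fun _ _ f ↦ ∀ W : MorphismProperty C, W.IsWeaklySaturated → U ≤ W → W f

end CategoryTheory.MorphismProperty

namespace HomotopicalAlgebra

section ModelCategory

variable (C : Type u) [Category.{v} C] [ModelCategory C]

/-- `I` is a (small) set of generating cofibrations. When `C` is locally presentable,
all objects are small, so that no further smallness condition on `I` is needed. -/
structure IsGeneratingCofibrations (I : MorphismProperty C) : Prop where
  isSmall : MorphismProperty.IsSmall.{v} I
  rlp_eq : I.rlp = trivialFibrations C

/-- `J` is a (small) set of generating trivial cofibrations. -/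
structure IsGeneratingTrivialCofibrations (J : MorphismProperty C) : Prop where
  isSmall : MorphismProperty.IsSmall.{v} J
  rlp_eq : J.rlp = fibrations C

/-- A model category is combinatorial if it is locally presentable and cofibrantly generated. -/
structure IsCombinatorial : Prop where
  isLocallyPresentable : IsLocallyPresentable.{v} C
  exists_generatingCofibrations : ∃ I, IsGeneratingCofibrations C I
  exists_generatingTrivialCofibrations : ∃ J, IsGeneratingTrivialCofibrations C J

end ModelCategory

section Monoidal

variable (C : Type u) [Category.{v} C] [MonoidalCategory C]

/-- A monoidal category is biclosed if tensoring with any object, on either side,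
has a right adjoint. -/
structure IsBiclosed : Prop where
  isLeftAdjoint_tensorLeft (X : C) : (tensorLeft X).IsLeftAdjoint
  isLeftAdjoint_tensorRight (X : C) : (tensorRight X).IsLeftAdjoint

variable [ModelCategory C]

/-- The pushout-product `f □ g : A ⊗ B' ⨿_{A ⊗ A'} B ⊗ A' ⟶ B ⊗ B'` of morphisms
`f : A ⟶ B` and `g : A' ⟶ B'`. -/
noncomputable abbrev pushoutProd {C : Type u} [Category.{v} C] [MonoidalCategory C]
    [ModelCategory C] (f g : Arrow C) : Arrow C :=
  (MonoidalCategory.Arrow.pushoutProduct.obj f).obj g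

/-- A (biclosed) monoidal model category: a model category with a biclosed monoidal structure
whose unit is cofibrant and whose tensor product is a left Quillen bifunctor. No symmetry is
assumed. (The tensor product preserves colimits in each variable by biclosedness.) -/
structure IsMonoidalModelCategory : Prop where
  isBiclosed : IsBiclosed C
  isCofibrant_unit : IsCofibrant (𝟙_ C)
  cofibrations_pushoutProd (f g : Arrow C) :
    cofibrations C f.hom → cofibrations C g.hom → cofibrations C (pushoutProd f g).hom
  trivialCofibrations_pushoutProd_left (f g : Arrow C) :
    trivialCofibrations C f.hom → cofibrations C g.hom →
      trivialCofibrations C (pushoutProd f g).hom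
  trivialCofibrations_pushoutProd_right (f g : Arrow C) :
    cofibrations C f.hom → trivialCofibrations C g.hom →
      trivialCofibrations C (pushoutProd f g).hom

/-- The iterated pushout-product `f □ (g₁ □ (g₂ □ ⋯))` of a nonempty list `f, g₁, g₂, …`. -/
noncomputable def iteratedPushoutProd {C : Type u} [Category.{v} C] [MonoidalCategory C]
    [ModelCategory C] : Arrow C → List (Arrow C) → Arrow C
  | f, [] => f
  | f, g :: l => pushoutProd f (iteratedPushoutProd g l)

/-- The class of morphisms `f₁ □ ⋯ □ fₙ` (`n ≥ 1`), up to isomorphism, where each `fᵢ` is a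
trivial cofibration or of the form `∅ ⟶ X` for some object `X`, at least one `fᵢ` being a
trivial cofibration. -/
def monoidAxiomClass : MorphismProperty C := fun _ _ f ↦
  ∃ (g : Arrow C) (l : List (Arrow C)),
    (∀ h ∈ g :: l, trivialCofibrations C h.hom ∨ Nonempty (IsInitial h.left)) ∧
    (∃ h ∈ g :: l, trivialCofibrations C h.hom) ∧
    Nonempty (Arrow.mk f ≅ iteratedPushoutProd g l)

/-- The non-symmetric monoid axiom. -/
def MonoidAxiom : Prop :=
  (monoidAxiomClass C).weakSaturation ≤ weakEquivalences C

end Monoidal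

section Transfer

variable {C : Type u} [Category.{v} C] [ModelCategory C]
  {D : Type u'} [Category.{v} D]

/-- A morphism of `D` is a weak equivalence (resp. a fibration) if and only if
its image under `U` is. -/
structure IsTransferred [ModelCategory D] (U : D ⥤ C) : Prop where
  weakEquivalence_iff {X Y : D} (f : X ⟶ Y) :
    weakEquivalences D f ↔ weakEquivalences C (U.map f)
  fibration_iff {X Y : D} (f : X ⟶ Y) : fibrations D f ↔ fibrations C (U.map f)

/-- `D` is combinatorial, and the left adjoint `F` sends any sets of generating (trivial)
cofibrations of `C` to sets of generating (trivial) cofibrations of `D`. -/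
structure IsCombinatoriallyGeneratedBy [ModelCategory D] (F : C ⥤ D) : Prop where
  isCombinatorial : IsCombinatorial D
  generatingCofibrations (I : MorphismProperty C) :
    IsGeneratingCofibrations C I → IsGeneratingCofibrations D (I.strictMap F)
  generatingTrivialCofibrations (J : MorphismProperty C) :
    IsGeneratingTrivialCofibrations C J → IsGeneratingTrivialCofibrations D (J.strictMap F)

/-- A monad `T` on a (combinatorial) model category is combinatorially admissible if there is
a model structure on the category of `T`-algebras whose weak equivalences and fibrations are
detected in `C`, and this model structure is combinatorial, with the images under the free
algebra functor of sets of generating (trivial) cofibrations of `C` as generating (trivial)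
cofibrations. -/
def IsCombinatoriallyAdmissible (T : Monad C) : Prop :=
  ∃ _ : ModelCategory T.Algebra, IsTransferred T.forget ∧ IsCombinatoriallyGeneratedBy T.free

end Transfer

end HomotopicalAlgebra

/-! Kan's transfer along `F ⊣ U` (`exists_modelCategory_isTransferred`) leaves two things to prove:
`Mon C` is locally presentable, and every morphism with the left lifting property against the right
lifting class of `F` (trivial cofibrations) is a weak equivalence in `C`.

For the first, biclosedness makes `⊗` preserve colimits in each variable, so `U` preserves sifted
colimits. Hence `U` is monadic, `Mon C` has the colimits of `C`, and `F` sends a strong generator of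
presentable objects to another one. Monadicity also carries the model structure over to
`T`-algebras.

For the second, the small object argument reduces to a pushout `ψ : X ⟶ P` of `F j`, with `j : A ⟶
B` a trivial cofibration (`IsWeaklySaturated.of_isPushout_mon`). A left `P`-module is a left
`X`-module with an action of `B` extending that of `A`. Such an action is forced on the `X`-module
`X` by attaching cells: if `m` is the inclusion of the previous stage, the next one is a cobase
change of `X ⊗ (j □ m) ≅ (∅ ⟶ X) □ j □ m`, so the monoid axiom controls the colimit `X ⟶ Q`
(`PartialExtension.exists_extension`). There is no need to identify `Q` with `P`: the monoid of
endomorphisms of `Q` lying over left multiplications of `P` receives `X` and `B`, hence `P`, and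
acting on the unit gives a section of `Q ⟶ P` (`exists_section_of_equivariant`). So `ψ` is a retract
of `X ⟶ Q`. -/

namespace CategoryTheory

/-! ### Locally presentable categories: small object argument, generators and lifting along an
adjunction. -/

section Presentable

variable {C : Type u} [Category.{v} C]

lemma exists_isRegular_forall_isCardinalPresentable [IsLocallyPresentable.{v} C]
    {ι : Type v} (X : ι → C) :
    ∃ (κ : Cardinal.{v}) (_ : Fact κ.IsRegular), ∀ i, IsCardinalPresentable (X i) κ := by
  have h (i : ι) : ∃ (κ : Cardinal.{v}) (_ : Fact κ.IsRegular),
      IsCardinalPresentable (X i) κ := by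
    obtain ⟨κ, hκ, h⟩ := (inferInstance : IsPresentable.{v} (X i))
    exact ⟨κ, hκ, h⟩
  choose κ hκ hX using h
  obtain ⟨κ', hκ', h⟩ := HasCardinalLT.exists_regular_cardinal_forall.{v} (fun i ↦ (κ i).ord.ToType)
  refine ⟨κ', ⟨hκ'⟩, fun i ↦ ?_⟩
  have : Fact κ'.IsRegular := ⟨hκ'⟩
  refine isCardinalPresentable_of_le (X i) (κ := κ i) (le_of_lt ?_)
  simpa [hasCardinalLT_iff_cardinal_mk_lt] using h i

/-- The sources of a small set of morphisms are all `κ`-presentable for a single regular `κ`, so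
maps out of them commute with colimits of chains indexed by `κ`. -/
lemma MorphismProperty.hasSmallObjectArgument_of_isLocallyPresentable
    [IsLocallyPresentable.{v} C] (I : MorphismProperty C) [MorphismProperty.IsSmall.{v} I] :
    HasSmallObjectArgument.{v} I := by
  obtain ⟨κ₀, _, _⟩ := IsLocallyPresentable.exists_cardinal.{v} C
  obtain ⟨ι, A, B, f, rfl⟩ := (isSmall_iff_eq_ofHoms.{v} I).1 inferInstance
  obtain ⟨κ, hκ, hA⟩ := exists_isRegular_forall_isCardinalPresentable A
  have : Nonempty κ.ord.ToType := by simpa using hκ.out.ne_zero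
  have := WellFoundedLT.toOrderBot κ.ord.ToType
  refine ⟨κ, hκ, this, { preservesColimit := ?_ }⟩
  rintro A' B' X Y i hi f' hf
  obtain ⟨i⟩ := hi
  have := hA i
  have := preservesColimitsOfShape_of_isCardinalPresentable (A i) κ κ.ord.ToType
  infer_instance

end Presentable

section Generator

variable {C : Type u} [Category.{v} C] {D : Type u'} [Category.{v} D]
  {F : C ⥤ D} {U : D ⥤ C}

lemma ObjectProperty.IsStrongGenerator.map_leftAdjoint {P : ObjectProperty C}
    (hP : P.IsStrongGenerator) (adj : F ⊣ U) [U.Faithful] [U.ReflectsIsomorphisms] :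
    (P.strictMap F).IsStrongGenerator := by
  rw [isStrongGenerator_iff]
  refine ⟨fun X Y f g h ↦ U.map_injective (hP.isSeparating _ _ fun G hG k ↦ ?_),
    fun X Y i _ hi ↦ ?_⟩
  · have := h _ (P.strictMap_obj F hG) ((adj.homEquiv _ _).symm k)
    rw [← adj.homEquiv_naturality_right_symm, ← adj.homEquiv_naturality_right_symm] at this
    exact (adj.homEquiv _ _).symm.injective this
  · have : PreservesLimitsOfSize.{0, 0} U := adj.rightAdjoint_preservesLimits
    have : Mono (U.map i) := inferInstance
    have : IsIso (U.map i) := hP.isIso_of_mono _ fun G hG k ↦ by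
      obtain ⟨l, hl⟩ := hi _ (P.strictMap_obj F hG) ((adj.homEquiv _ _).symm k)
      refine ⟨adj.homEquiv _ _ l, ?_⟩
      simp [← adj.homEquiv_naturality_right, hl]
    exact isIso_of_reflects_iso i U

/-- The left adjoint of an accessible functor preserves presentable objects, and it preserves strong
generators when `U` is faithful and conservative. -/
lemma isLocallyPresentable_of_adjunction [IsLocallyPresentable.{v} C] (adj : F ⊣ U)
    [U.Faithful] [U.ReflectsIsomorphisms] [HasColimitsOfSize.{v, v} D]
    (hU : ∀ (J : Type v) [SmallCategory J] [IsFiltered J], PreservesColimitsOfShape J U) :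
    IsLocallyPresentable.{v} D := by
  obtain ⟨κ, _, _⟩ := IsLocallyPresentable.exists_cardinal.{v} C
  obtain ⟨P, _, hP, hP'⟩ :=
    (IsCardinalLocallyPresentable.iff_exists_isStrongGenerator C κ).1 inferInstance
  refine ⟨κ, inferInstance,
    (IsCardinalLocallyPresentable.iff_exists_isStrongGenerator D κ).2
      ⟨P.strictMap F, ?_, hP.map_leftAdjoint adj, ?_⟩⟩
  · exact small_of_surjective (f := fun (x : Subtype P) ↦ ⟨F.obj x.1, P.strictMap_obj F x.2⟩)
      (by rintro ⟨_, ⟨X, hX⟩⟩; exact ⟨⟨X, hX⟩, rfl⟩)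
  · rintro _ ⟨X, hX⟩
    have : IsCardinalPresentable X κ := hP' _ hX
    have : U.IsCardinalAccessible κ := ⟨fun J _ _ ↦ by
      have := isFiltered_of_isCardinalFiltered J κ
      exact hU J⟩
    exact adj.isCardinalPresentable_leftAdjoint_obj κ X

end Generator

section Lifting

variable {C : Type u} [Category.{v} C] {D : Type u'} [Category.{v} D]
  {F : C ⥤ D} {U : D ⥤ C}

lemma MorphismProperty.rlp_strictMap (I : MorphismProperty C) (adj : F ⊣ U) :
    (I.strictMap F).rlp = I.rlp.inverseImage U := by
  ext X Y p
  refine ⟨fun h A B i hi ↦ (adj.hasLiftingProperty_iff i p).1 (h _ (I.map_mem_strictMap F i hi)),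
    ?_⟩
  rintro h _ _ _ ⟨hi⟩
  exact (adj.hasLiftingProperty_iff _ p).2 (h _ hi)

lemma MorphismProperty.isSmall_strictMap (I : MorphismProperty C) [MorphismProperty.IsSmall.{v} I]
    (F : C ⥤ D) : MorphismProperty.IsSmall.{v} (I.strictMap F) := by
  obtain ⟨ι, A, B, f, rfl⟩ := (isSmall_iff_eq_ofHoms.{v} I).1 inferInstance
  have : (ofHoms f).strictMap F = ofHoms (fun i ↦ F.map (f i)) := by
    ext X Y g
    constructor
    · rintro ⟨⟨i⟩⟩
      exact ⟨i⟩
    · rintro ⟨i⟩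
      exact ⟨⟨i⟩⟩
  rw [this]
  infer_instance

end Lifting

end CategoryTheory

/-! ### Transfer of model structures. -/

namespace HomotopicalAlgebra

variable {C : Type u} [Category.{v} C] [ModelCategory C]
  {D : Type u'} [Category.{v} D] {F : C ⥤ D} {U : D ⥤ C}

lemma IsTransferred.trivialFibrations_eq [ModelCategory D] (h : IsTransferred U) :
    trivialFibrations D = (trivialFibrations C).inverseImage U := by
  ext X Y f
  exact and_congr (h.fibration_iff f) (h.weakEquivalence_iff f)

lemma IsTransferred.fibrations_eq [ModelCategory D] (h : IsTransferred U) :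
    fibrations D = (fibrations C).inverseImage U := by
  ext X Y f
  exact h.fibration_iff f

lemma IsTransferred.isCombinatoriallyGeneratedBy [ModelCategory D] (h : IsTransferred U)
    (adj : F ⊣ U) (hC : IsCombinatorial C) (hD : IsLocallyPresentable.{v} D) :
    IsCombinatoriallyGeneratedBy F := by
  have h₁ (I : MorphismProperty C) (hI : IsGeneratingCofibrations C I) :
      IsGeneratingCofibrations D (I.strictMap F) :=
    ⟨have := hI.isSmall; I.isSmall_strictMap F, by
      rw [I.rlp_strictMap adj, hI.rlp_eq, h.trivialFibrations_eq]⟩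
  have h₂ (J : MorphismProperty C) (hJ : IsGeneratingTrivialCofibrations C J) :
      IsGeneratingTrivialCofibrations D (J.strictMap F) :=
    ⟨have := hJ.isSmall; J.isSmall_strictMap F, by
      rw [J.rlp_strictMap adj, hJ.rlp_eq, h.fibrations_eq]⟩
  obtain ⟨I, hI⟩ := hC.exists_generatingCofibrations
  obtain ⟨J, hJ⟩ := hC.exists_generatingTrivialCofibrations
  exact ⟨⟨hD, ⟨_, h₁ I hI⟩, ⟨_, h₂ J hJ⟩⟩, h₁, h₂⟩

lemma exists_modelCategory_isTransferred (adj : F ⊣ U) (hC : IsCombinatorial C)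
    [IsLocallyPresentable.{v} D] [HasFiniteLimits D]
    (hU : ((trivialCofibrations C).strictMap F).rlp.llp ≤ (weakEquivalences C).inverseImage U) :
    ∃ _ : ModelCategory D, IsTransferred U := by
  obtain ⟨κ₀, _, _⟩ := IsLocallyPresentable.exists_cardinal.{v} D
  obtain ⟨I, hI⟩ := hC.exists_generatingCofibrations
  obtain ⟨J, hJ⟩ := hC.exists_generatingTrivialCofibrations
  have := hI.isSmall
  have := hJ.isSmall
  have := I.isSmall_strictMap F
  have := J.isSmall_strictMap F
  have := (I.strictMap F).hasSmallObjectArgument_of_isLocallyPresentable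
  have := (J.strictMap F).hasSmallObjectArgument_of_isLocallyPresentable
  -- The acyclicity hypothesis `hU` does not depend on `J`; this identity turns it into a statement
  -- about the class to which the small object argument applies.
  have hJ' : (J.strictMap F).rlp = ((trivialCofibrations C).strictMap F).rlp := by
    rw [J.rlp_strictMap adj, MorphismProperty.rlp_strictMap _ adj, hJ.rlp_eq,
      MorphismProperty.rlp_eq_of_wfs (trivialCofibrations C) (fibrations C)]
  let : CategoryWithWeakEquivalences D := ⟨(weakEquivalences C).inverseImage U⟩
  let : CategoryWithFibrations D := ⟨(fibrations C).inverseImage U⟩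
  let : CategoryWithCofibrations D := ⟨(I.strictMap F).rlp.llp⟩
  have hT : trivialFibrations D = (I.strictMap F).rlp := by
    rw [I.rlp_strictMap adj, hI.rlp_eq]
    rfl
  have hF : fibrations D = (J.strictMap F).rlp := by
    rw [J.rlp_strictMap adj, hJ.rlp_eq]
    rfl
  have hcof : cofibrations D = (I.strictMap F).rlp.llp := rfl
  have : (weakEquivalences D).HasTwoOutOfThreeProperty :=
    inferInstanceAs ((weakEquivalences C).inverseImage U).HasTwoOutOfThreeProperty
  have : HasFiniteColimits D := inferInstance
  have hwfs (K : MorphismProperty D) [MorphismProperty.HasSmallObjectArgument.{v} K] :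
      MorphismProperty.IsWeakFactorizationSystem K.rlp.llp K.rlp :=
    { rlp := K.rlp_llp_rlp
      llp := rfl }
  have h₁ : MorphismProperty.IsWeakFactorizationSystem (cofibrations D) (trivialFibrations D) := by
    rw [hT, hcof]
    exact hwfs _
  have h₂ : MorphismProperty.IsWeakFactorizationSystem (trivialCofibrations D)
      (fibrations D) := by
    have : trivialCofibrations D = (J.strictMap F).rlp.llp := by
      apply le_antisymm
      -- Retract argument: in the factorization of `f`, the second map is a weak equivalence by
      -- two-out-of-three, so the cofibration `f` lifts against it.
      · intro A B f hf
        have fac := MorphismProperty.factorizationData (J.strictMap F).rlp.llp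
          (J.strictMap F).rlp f
        have hi : weakEquivalences D fac.i := hU _ (hJ' ▸ fac.hi)
        have hp : weakEquivalences D fac.p :=
          (weakEquivalences D).of_precomp fac.i fac.p hi (by rw [fac.fac]; exact hf.2)
        have hp' : trivialFibrations D fac.p := ⟨by rw [hF]; exact fac.hp, hp⟩
        have := MorphismProperty.hasLiftingProperty_of_wfs f fac.p hf.1 hp'
        exact MorphismProperty.of_retract (RetractArrow.ofLeftLiftingProperty fac.fac) fac.hi
      · refine le_inf ?_ (fun _ _ f hf ↦ hU f (hJ' ▸ hf))
        rw [hcof, ← hF, ← hT]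
        exact MorphismProperty.antitone_llp inf_le_left
    rw [this, hF]
    exact hwfs _
  let m : ModelCategory D := ModelCategory.mk' D
  exact ⟨m, ⟨fun _ ↦ Iff.rfl, fun _ ↦ Iff.rfl⟩⟩

/-- A transferred model structure is transported along an equivalence over the base. -/
lemma IsTransferred.exists_of_equivalence {D' : Type*} [Category.{v} D'] [ModelCategory D]
    (h : IsTransferred U) {U' : D' ⥤ C} (e : D' ≌ D) (iso : e.functor ⋙ U ≅ U') :
    ∃ _ : ModelCategory D', IsTransferred U' := by
  let : CategoryWithWeakEquivalences D' := ⟨(weakEquivalences D).inverseImage e.functor⟩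
  let : CategoryWithFibrations D' := ⟨(fibrations D).inverseImage e.functor⟩
  let : CategoryWithCofibrations D' := ⟨(cofibrations D).inverseImage e.functor⟩
  let m : ModelCategory D' := ModelCategory.transport e rfl rfl rfl
  refine ⟨m, ⟨fun f ↦ ?_, fun f ↦ ?_⟩⟩
  · exact (h.weakEquivalence_iff _).trans
      (MorphismProperty.arrow_mk_iso_iff _
        (((Functor.mapArrowFunctor _ _).mapIso iso).app (Arrow.mk f)))
  · exact (h.fibration_iff _).trans
      (MorphismProperty.arrow_mk_iso_iff _
        (((Functor.mapArrowFunctor _ _).mapIso iso).app (Arrow.mk f)))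

end HomotopicalAlgebra

/-! ### Free monoids. -/

namespace CategoryTheory

variable {C : Type u} [Category.{v} C] [MonoidalCategory C]

/-- The tensor powers of an object. -/
def tensorPower (A : C) : ℕ → C
  | 0 => 𝟙_ C
  | n + 1 => A ⊗ tensorPower A n

/-- The data of an object `T` with a unit and an action of `A` which satisfies the universal
property of the free object on `Z` after tensoring with `Z` on the right. -/
structure FreeMonoidData (A : C) where
  /-- the underlying object of the free monoid -/
  T : C
  /-- the unit -/
  one : 𝟙_ C ⟶ T
  /-- the left multiplication by the generators -/
  act : A ⊗ T ⟶ T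
  exists_hom {Z N : C} (z : Z ⟶ N) (a : A ⊗ N ⟶ N) :
    ∃ h : T ⊗ Z ⟶ N, one ▷ Z ≫ h = (λ_ Z).hom ≫ z ∧
      act ▷ Z ≫ h = (α_ _ _ _).hom ≫ A ◁ h ≫ a
  hom_ext {Z N : C} (a : A ⊗ N ⟶ N) (h h' : T ⊗ Z ⟶ N) :
    one ▷ Z ≫ h = one ▷ Z ≫ h' →
    act ▷ Z ≫ h = (α_ _ _ _).hom ≫ A ◁ h ≫ a →
    act ▷ Z ≫ h' = (α_ _ _ _).hom ≫ A ◁ h' ≫ a → h = h'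

namespace FreeMonoidData

section Construction

variable [HasCoproducts.{0} C]

/-- The object is `∐ A^{⊗ n}`. Tensoring with `A` or `Z` preserves this coproduct, so equivariant
maps out of `T ⊗ Z` are built and compared by recursion on `n`. -/
lemma nonempty (hl : ∀ X : C, (tensorLeft X).IsLeftAdjoint)
    (hr : ∀ X : C, (tensorRight X).IsLeftAdjoint) (A : C) : Nonempty (FreeMonoidData A) := by
  let c := coproductIsCoproduct (tensorPower A)
  let T : C := ∐ (tensorPower A)
  let ι (n : ℕ) : tensorPower A n ⟶ T := Sigma.ι (tensorPower A) n
  have extR {Z N : C} {f g : T ⊗ Z ⟶ N} (h : ∀ n, ι n ▷ Z ≫ f = ι n ▷ Z ≫ g) : f = g := by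
    have := hr Z
    exact (isColimitOfPreserves (tensorRight Z) c).hom_ext (fun ⟨n⟩ ↦ h n)
  have extL {N : C} {f g : A ⊗ T ⟶ N} (h : ∀ n, A ◁ ι n ≫ f = A ◁ ι n ≫ g) : f = g := by
    have := hl A
    exact (isColimitOfPreserves (tensorLeft A) c).hom_ext (fun ⟨n⟩ ↦ h n)
  have extLR {Z N : C} {f g : (A ⊗ T) ⊗ Z ⟶ N}
      (h : ∀ n, (A ◁ ι n) ▷ Z ≫ f = (A ◁ ι n) ▷ Z ≫ g) : f = g := by
    have := hl A
    have := hr Z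
    exact (isColimitOfPreserves (tensorLeft A ⋙ tensorRight Z) c).hom_ext (fun ⟨n⟩ ↦ h n)
  have descR {Z N : C} (f : ∀ n, tensorPower A n ⊗ Z ⟶ N) :
      ∃ g : T ⊗ Z ⟶ N, ∀ n, ι n ▷ Z ≫ g = f n := by
    have := hr Z
    have hc := isColimitOfPreserves (tensorRight Z) c
    exact ⟨hc.desc (Cocone.mk N (Discrete.natTrans (fun ⟨n⟩ ↦ f n))), fun n ↦ hc.fac _ ⟨n⟩⟩
  have descL {N : C} (f : ∀ n, A ⊗ tensorPower A n ⟶ N) :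
      ∃ g : A ⊗ T ⟶ N, ∀ n, A ◁ ι n ≫ g = f n := by
    have := hl A
    have hc := isColimitOfPreserves (tensorLeft A) c
    exact ⟨hc.desc (Cocone.mk N (Discrete.natTrans (fun ⟨n⟩ ↦ f n))), fun n ↦ hc.fac _ ⟨n⟩⟩
  obtain ⟨act, hact⟩ := descL (fun n ↦ ι (n + 1))
  -- The inclusion of index `n + 1`, retyped with the unfolded source so that whiskering lemmas can
  -- rewrite it.
  let ι' (n : ℕ) : A ⊗ tensorPower A n ⟶ T := ι (n + 1)
  replace hact (n : ℕ) : A ◁ ι n ≫ act = ι' n := hact n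
  refine ⟨⟨T, ι 0, act, fun {Z N} z a ↦ ?_, fun {Z N} a h h' h₀ h₁ h₁' ↦ ?_⟩⟩
  · let f (n : ℕ) : tensorPower A n ⊗ Z ⟶ N :=
      Nat.rec ((λ_ Z).hom ≫ z) (fun n fn ↦ (α_ A (tensorPower A n) Z).hom ≫ A ◁ fn ≫ a) n
    obtain ⟨g, hg⟩ := descR f
    have hg' (n : ℕ) : ι' n ▷ Z ≫ g = (α_ A (tensorPower A n) Z).hom ≫ A ◁ f n ≫ a := hg (n + 1)
    refine ⟨g, hg 0, extLR fun n ↦ ?_⟩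
    rw [← comp_whiskerRight_assoc, hact, hg', associator_naturality_middle_assoc,
      ← whiskerLeft_comp_assoc, hg]
  · refine extR fun n ↦ ?_
    induction n with
    | zero => exact h₀
    | succ n hn =>
      change ι' n ▷ Z ≫ h = ι' n ▷ Z ≫ h'
      rw [← hact, comp_whiskerRight_assoc, comp_whiskerRight_assoc, h₁, h₁',
        associator_naturality_middle_assoc, associator_naturality_middle_assoc,
        ← whiskerLeft_comp_assoc, ← whiskerLeft_comp_assoc, hn]

end Construction

variable {A : C} (d : FreeMonoidData A)

/-- The multiplication of the free monoid. -/
noncomputable def mul : d.T ⊗ d.T ⟶ d.T := (d.exists_hom (𝟙 d.T) d.act).choose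

lemma one_mul : d.one ▷ d.T ≫ d.mul = (λ_ d.T).hom :=
  (d.exists_hom (𝟙 d.T) d.act).choose_spec.1.trans (Category.comp_id _)

lemma act_mul : d.act ▷ d.T ≫ d.mul = (α_ _ _ _).hom ≫ A ◁ d.mul ≫ d.act :=
  (d.exists_hom (𝟙 d.T) d.act).choose_spec.2

/-- Uniqueness of `A`-equivariant maps out of `T ⊗ Z`, here with `Z` the unit; associativity uses it
with `Z = T ⊗ T`. This is why `FreeMonoidData` carries the parameter `Z`. -/
lemma mul_one : d.T ◁ d.one ≫ d.mul = (ρ_ d.T).hom := by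
  refine d.hom_ext d.act _ _ ?_ ?_ ?_
  · rw [← whisker_exchange_assoc, one_mul, leftUnitor_naturality, rightUnitor_naturality,
      unitors_equal]
  · rw [← whisker_exchange_assoc, act_mul, MonoidalCategory.whiskerLeft_comp]
    simp
  · simp

lemma mul_assoc : d.mul ▷ d.T ≫ d.mul = (α_ _ _ _).hom ≫ d.T ◁ d.mul ≫ d.mul := by
  rw [← Iso.inv_comp_eq]
  refine d.hom_ext d.act _ _ ?_ ?_ ?_
  · rw [← whisker_exchange_assoc, one_mul, associator_inv_naturality_left_assoc,
      ← comp_whiskerRight_assoc, one_mul]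
    simp
  · rw [associator_inv_naturality_left_assoc, ← comp_whiskerRight_assoc, act_mul]
    simp [act_mul]
  · rw [← whisker_exchange_assoc, act_mul]
    simp

/-- The free monoid. -/
noncomputable def mon : Mon C where
  X := d.T
  mon :=
    { one := d.one
      mul := d.mul
      one_mul := d.one_mul
      mul_one := d.mul_one
      mul_assoc := d.mul_assoc }

/-- The inclusion of the generators in the free monoid. -/
def incl : A ⟶ d.T := (ρ_ A).inv ≫ A ◁ d.one ≫ d.act

open scoped CategoryTheory.MonObj

lemma act_eq : d.act = d.incl ▷ d.T ≫ d.mul := by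
  have : A ◁ (λ_ d.T).inv ≫ A ◁ d.one ▷ d.T ≫ A ◁ d.mul = 𝟙 _ := by
    rw [← MonoidalCategory.whiskerLeft_comp, ← MonoidalCategory.whiskerLeft_comp, one_mul]
    simp
  simp [incl, act_mul, reassoc_of% this]

lemma hom_ext' {N : C} (a : A ⊗ N ⟶ N) {f g : d.T ⟶ N} (h : d.one ≫ f = d.one ≫ g)
    (hf : d.act ≫ f = A ◁ f ≫ a) (hg : d.act ≫ g = A ◁ g ≫ a) : f = g := by
  rw [← cancel_epi (ρ_ d.T).hom]
  refine d.hom_ext a _ _ ?_ ?_ ?_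
  · simp [h]
  · simp [hf]
  · simp [hg]

lemma act_comp_of_mul_comp {M : C} [MonObj M] (φ : d.T ⟶ M)
    (h : d.mul ≫ φ = (φ ⊗ₘ φ) ≫ μ[M]) :
    d.act ≫ φ = A ◁ φ ≫ (d.incl ≫ φ) ▷ M ≫ μ[M] := by
  rw [act_eq, Category.assoc, h, MonoidalCategory.tensorHom_def, Category.assoc,
    whisker_exchange_assoc, comp_whiskerRight_assoc]

lemma act_comp_hom {M : Mon C} (f : d.mon ⟶ M) :
    d.act ≫ f.hom = A ◁ f.hom ≫ (d.incl ≫ f.hom) ▷ M.X ≫ μ[M.X] :=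
  d.act_comp_of_mul_comp f.hom (IsMonHom.mul_hom f.hom)

lemma mon_hom_ext {M : Mon C} {f g : d.mon ⟶ M} (h : d.incl ≫ f.hom = d.incl ≫ g.hom) : f = g := by
  ext
  refine d.hom_ext' ((d.incl ≫ f.hom) ▷ M.X ≫ μ[M.X]) ?_ (d.act_comp_hom f) ?_
  · exact (IsMonHom.one_hom f.hom).trans (IsMonHom.one_hom g.hom).symm
  · rw [h]
    exact d.act_comp_hom g

lemma exists_lift {M : Mon C} (f : A ⟶ M.X) : ∃ φ : d.mon ⟶ M, d.incl ≫ φ.hom = f := by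
  -- `A` acts on `M` through `f`; the lift is the equivariant map determined by the unit of `M`, and
  -- its multiplicativity again follows from uniqueness, with `Z = T`.
  let a : A ⊗ M.X ⟶ M.X := f ▷ M.X ≫ μ[M.X]
  obtain ⟨h, h₁, h₂⟩ := d.exists_hom (Z := 𝟙_ C) η[M.X] a
  obtain ⟨φ, rfl⟩ : ∃ φ : d.T ⟶ M.X, h = (ρ_ _).hom ≫ φ := ⟨(ρ_ _).inv ≫ h, by simp⟩
  have hone : d.one ≫ φ = η[M.X] := by
    rw [rightUnitor_naturality_assoc, unitors_equal] at h₁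
    simpa using h₁
  have hact : d.act ≫ φ = A ◁ φ ≫ a := by
    rw [rightUnitor_naturality_assoc] at h₂
    simpa using h₂
  have hmul : d.mul ≫ φ = (φ ⊗ₘ φ) ≫ μ[M.X] := by
    refine d.hom_ext a _ _ ?_ ?_ ?_
    · rw [reassoc_of% d.one_mul, MonoidalCategory.tensorHom_def, Category.assoc,
        ← comp_whiskerRight_assoc, hone, ← whisker_exchange_assoc, MonObj.one_mul,
        leftUnitor_naturality]
    · rw [reassoc_of% d.act_mul, hact]
      simp
    · dsimp only [a]
      rw [MonoidalCategory.tensorHom_def, Category.assoc, ← comp_whiskerRight_assoc, hact]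
      dsimp only [a]
      simp only [comp_whiskerRight, Category.assoc, whiskerLeft_comp, whisker_assoc]
      rw [← whisker_exchange_assoc, ← whisker_exchange_assoc, MonObj.mul_assoc]
      simp [whisker_exchange_assoc]
  refine ⟨Mon.Hom.mk' φ hone hmul, ?_⟩
  change d.incl ≫ φ = f
  rw [incl, Category.assoc, Category.assoc, hact, ← whiskerLeft_comp_assoc, hone]
  dsimp only [a]
  rw [whisker_exchange_assoc, MonObj.mul_one]
  simp

end FreeMonoidData

lemma Mon.isRightAdjoint_forget [HasCoproducts.{0} C]
    (hl : ∀ X : C, (tensorLeft X).IsLeftAdjoint)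
    (hr : ∀ X : C, (tensorRight X).IsLeftAdjoint) :
    (Mon.forget C).IsRightAdjoint := by
  let d (A : C) : FreeMonoidData A := (FreeMonoidData.nonempty hl hr A).some
  have hd (A : C) (M : Mon C) :
      Function.Bijective (fun (φ : (d A).mon ⟶ M) ↦ ((d A).incl ≫ φ.hom : A ⟶ M.X)) :=
    ⟨fun _ _ h ↦ (d A).mon_hom_ext h, fun f ↦ (d A).exists_lift f⟩
  exact (Adjunction.adjunctionOfEquivLeft (G := Mon.forget C)
    (fun A M ↦ Equiv.ofBijective _ (hd A M))
    (fun A M N f g ↦ (Category.assoc (d A).incl g.hom f.hom).symm)).isRightAdjoint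

end CategoryTheory

namespace CategoryTheory

/-! ### Reflexive pairs form a sifted shape. -/

section Sifted

namespace Limits.WalkingReflexivePair

open Hom

/-- A chosen map to the object `zero`. -/
def toZero : ∀ a : WalkingReflexivePair, a ⟶ zero
  | zero => 𝟙 zero
  | one => left

/-- `hp` switches `left` to `right` in both coordinates at once. Precomposing one coordinate with
`reflexion`, which equalizes `left` and `right`, freezes it, so the other can be switched alone. -/
lemma iff_of_forall_iff_toZero {a b : WalkingReflexivePair} (p : (a ⟶ zero) → (b ⟶ zero) → Prop)
    (hp : ∀ (x : a ⟶ one) (y : b ⟶ one), p (x ≫ left) (y ≫ left) ↔ p (x ≫ right) (y ≫ right))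
    (h₀ : p (toZero a) (toZero b)) (x : a ⟶ zero) (y : b ⟶ zero) : p x y := by
  cases a with
  | zero =>
    change Hom zero zero at x
    cases x
    cases b with
    | zero =>
      change Hom zero zero at y
      cases y
      exact h₀
    | one =>
      change Hom one zero at y
      cases y
      · exact h₀
      · exact (hp reflexion (𝟙 one)).1 h₀
  | one =>
    change Hom one zero at x
    cases b with
    | zero =>
      change Hom zero zero at y
      cases y
      cases x
      · exact h₀
      · exact (hp (𝟙 one) reflexion).1 h₀
    | one =>
      change Hom one zero at y
      have h₁ : p right right := (hp (𝟙 one) (𝟙 one)).1 h₀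
      cases x <;> cases y
      · exact h₀
      · exact (hp (left ≫ reflexion) (𝟙 one)).1 h₀
      · exact (hp (𝟙 one) (left ≫ reflexion)).1 h₀
      · exact h₁

instance : IsSifted WalkingReflexivePair where
  out := by
    rintro ⟨a, b⟩
    refine IsConnected.of_induct
      (j₀ := StructuredArrow.mk (Y := zero) (Prod.mkHom (toZero a) (toZero b))) ?_
    intro p h₀ h
    have key (x : a ⟶ zero) (y : b ⟶ zero) :
        StructuredArrow.mk (S := (a, b)) (T := Functor.diag _) (Y := zero)
          (Prod.mkHom x y) ∈ p := by
      refine iff_of_forall_iff_toZero (fun x y ↦ StructuredArrow.mk (S := (a, b))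
        (T := Functor.diag _) (Y := zero) (Prod.mkHom x y) ∈ p) (fun x y ↦ ?_) h₀ x y
      let s : StructuredArrow (a, b) (Functor.diag WalkingReflexivePair) :=
        StructuredArrow.mk (Y := one) (Prod.mkHom x y)
      exact (h (StructuredArrow.homMk (f := s)
        (f' := StructuredArrow.mk (Y := zero) (Prod.mkHom (x ≫ left) (y ≫ left))) left)).symm.trans
        (h (StructuredArrow.homMk (f := s)
        (f' := StructuredArrow.mk (Y := zero) (Prod.mkHom (x ≫ right) (y ≫ right))) right))
    rintro ⟨⟨⟨⟩⟩, c, ⟨x, y⟩⟩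
    cases c
    · exact key x y
    · exact (h (StructuredArrow.homMk (f := StructuredArrow.mk (Y := one) (Prod.mkHom x y))
        (f' := StructuredArrow.mk (Y := zero) (Prod.mkHom (x ≫ left) (y ≫ left))) left)).2
        (key (x ≫ left) (y ≫ left))
  nonempty := ⟨zero⟩

end Limits.WalkingReflexivePair

end Sifted

/-! ### Sifted colimits of monoids. -/

namespace Mon

variable {C : Type u} [Category.{v} C] [MonoidalCategory C]
  (hl : ∀ X : C, (tensorLeft X).IsLeftAdjoint) (hr : ∀ X : C, (tensorRight X).IsLeftAdjoint)

open scoped CategoryTheory.MonObj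

section

variable {J : Type*} [Category J] (F : J ⥤ Mon C)

include hl hr

lemma preservesColimit₂_curriedTensor (F₁ F₂ : J ⥤ C) :
    PreservesColimit₂ F₁ F₂ (curriedTensor C) := by
  have (X : C) : PreservesColimit F₂ ((curriedTensor C).obj X) := by
    have := hl X
    exact inferInstanceAs (PreservesColimit F₂ (tensorLeft X))
  have (X : C) : PreservesColimit F₁ ((curriedTensor C).flip.obj X) := by
    have := hr X
    exact inferInstanceAs (PreservesColimit F₁ (tensorRight X))
  infer_instance

variable [IsSifted J]

lemma exists_isColimit_of_isSifted [HasColimitsOfShape J C] :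
    ∃ (c : Cocone F), Nonempty (IsColimit c) ∧
      Nonempty (IsColimit ((Mon.forget C).mapCocone c)) := by
  -- Siftedness enters here: `L ⊗ L` and `(L ⊗ L) ⊗ L` are colimits of the diagonal diagrams, so
  -- multiplication and associativity can be treated with a single index `j`.
  obtain ⟨L, q, w, hc, desc, ext, desc₂, ext₂, ext₃, extl, extr⟩ :
    ∃ (L : C) (q : ∀ j, (F.obj j).X ⟶ L)
      (w : ∀ {i j : J} (f : i ⟶ j), (F.map f).hom ≫ q j = q i),
      Nonempty (IsColimit (Cocone.mk (F := F ⋙ Mon.forget C) L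
        { app := q, naturality i j f := (w f).trans (Category.comp_id _).symm })) ∧
      (∀ {N : C} (f : ∀ j, (F.obj j).X ⟶ N),
        (∀ {i j : J} (t : i ⟶ j), (F.map t).hom ≫ f j = f i) →
        ∃ g : L ⟶ N, ∀ j, q j ≫ g = f j) ∧
      (∀ {N : C} {f g : L ⟶ N}, (∀ j, q j ≫ f = q j ≫ g) → f = g) ∧
      (∀ {N : C} (f : ∀ j, (F.obj j).X ⊗ (F.obj j).X ⟶ N),
        (∀ {i j : J} (t : i ⟶ j), ((F.map t).hom ⊗ₘ (F.map t).hom) ≫ f j = f i) →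
        ∃ g : L ⊗ L ⟶ N, ∀ j, (q j ⊗ₘ q j) ≫ g = f j) ∧
      (∀ {N : C} {f g : L ⊗ L ⟶ N}, (∀ j, (q j ⊗ₘ q j) ≫ f = (q j ⊗ₘ q j) ≫ g) → f = g) ∧
      (∀ {N : C} {f g : (L ⊗ L) ⊗ L ⟶ N},
        (∀ j, ((q j ⊗ₘ q j) ⊗ₘ q j) ≫ f = ((q j ⊗ₘ q j) ⊗ₘ q j) ≫ g) → f = g) ∧
      (∀ {N Z : C} {f g : Z ⊗ L ⟶ N}, (∀ j, Z ◁ q j ≫ f = Z ◁ q j ≫ g) → f = g) ∧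
      (∀ {N Z : C} {f g : L ⊗ Z ⟶ N}, (∀ j, q j ▷ Z ≫ f = q j ▷ Z ≫ g) → f = g) := by
    let G := F ⋙ Mon.forget C
    have := preservesColimit₂_curriedTensor hl hr G G
    have := preservesColimit₂_curriedTensor hl hr (G ⊗ G) G
    let c : Cocone G := colimit.cocone G
    let hc : IsColimit c := colimit.isColimit G
    let hc₂ : IsColimit (c.tensor c) := hc.tensor hc
    let hc₃ : IsColimit ((c.tensor c).tensor c) := hc₂.tensor hc
    refine ⟨c.pt, c.ι.app, fun f ↦ c.w f, ⟨hc⟩, fun {N} f hf ↦ ?_, fun h ↦ hc.hom_ext h,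
      fun {N} f hf ↦ ?_, fun h ↦ hc₂.hom_ext h, fun h ↦ hc₃.hom_ext h,
      fun {N Z f g} h ↦ ?_, fun {N Z f g} h ↦ ?_⟩
    · let s : Cocone G := Cocone.mk N
        { app := f, naturality i j t := (hf t).trans (Category.comp_id _).symm }
      exact ⟨hc.desc s, hc.fac s⟩
    · let s : Cocone (G ⊗ G) := Cocone.mk N
        { app := f, naturality i j t := (hf t).trans (Category.comp_id _).symm }
      exact ⟨hc₂.desc s, hc₂.fac s⟩
    · have := hl Z
      exact (isColimitOfPreserves (tensorLeft Z) hc).hom_ext h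
    · have := hr Z
      exact (isColimitOfPreserves (tensorRight Z) hc).hom_ext h
  obtain ⟨m, hm⟩ := desc₂ (fun j ↦ μ[(F.obj j).X] ≫ q j) (fun {i j} t ↦ by
    rw [← w t, ← IsMonHom.mul_hom_assoc (F.map t).hom])
  have h_one {i j : J} (f : i ⟶ j) : η[(F.obj i).X] ≫ q i = η[(F.obj j).X] ≫ q j := by
    rw [← w f, ← IsMonHom.one_hom (F.map f).hom, Category.assoc]
  -- The unit is well defined because a sifted category is connected.
  obtain ⟨e, he⟩ : ∃ e : 𝟙_ C ⟶ L, ∀ j, η[(F.obj j).X] ≫ q j = e :=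
    ⟨_, fun j ↦ constant_of_preserves_morphisms (fun j ↦ η[(F.obj j).X] ≫ q j)
      (fun _ _ f ↦ h_one f) j (IsSifted.nonempty (C := J)).some⟩
  let P : Mon C :=
    { X := L
      mon :=
        { one := e
          mul := m
          one_mul := extl fun j ↦ by
            rw [← he j, comp_whiskerRight_assoc, whisker_exchange_assoc,
              ← tensorHom_def'_assoc, hm]
            simp
          mul_one := extr fun j ↦ by
            rw [← he j, MonoidalCategory.whiskerLeft_comp_assoc, ← whisker_exchange_assoc,
              ← tensorHom_def_assoc, hm]
            simp
          mul_assoc := ext₃ fun j ↦ by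
            rw [← tensorHom_id, tensorHom_comp_tensorHom_assoc, hm, associator_naturality_assoc,
              ← id_tensorHom, tensorHom_comp_tensorHom_assoc, hm, Category.comp_id]
            have h₁ : (μ[(F.obj j).X] ≫ q j) ⊗ₘ q j =
                μ[(F.obj j).X] ▷ (F.obj j).X ≫ (q j ⊗ₘ q j) := by
              rw [MonoidalCategory.tensorHom_def, MonoidalCategory.tensorHom_def,
                comp_whiskerRight, Category.assoc]
            have h₂ : q j ⊗ₘ (μ[(F.obj j).X] ≫ q j) =
                (F.obj j).X ◁ μ[(F.obj j).X] ≫ (q j ⊗ₘ q j) := by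
              rw [tensorHom_def', tensorHom_def', MonoidalCategory.whiskerLeft_comp,
                Category.assoc]
            rw [h₁, h₂, Category.assoc, Category.assoc, hm, MonObj.mul_assoc_assoc] } }
  let c : Cocone F := Cocone.mk P
    { app j := Mon.Hom.mk' (q j) (he j) (hm j).symm
      naturality i j f := by
        ext
        exact (w f).trans (Category.comp_id _).symm }
  have h_desc (s : Cocone F) : ∃ f : P ⟶ s.pt, ∀ j, q j ≫ f.hom = (s.ι.app j).hom := by
    obtain ⟨f, hf⟩ := desc (N := s.pt.X) (fun j ↦ (s.ι.app j).hom)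
      (fun t ↦ congr_arg Mon.Hom.hom (s.w t))
    refine ⟨Mon.Hom.mk' f ?_ (ext₂ fun j ↦ ?_), hf⟩
    · change e ≫ f = _
      let j := (IsSifted.nonempty (C := J)).some
      rw [← he j, Category.assoc, hf, IsMonHom.one_hom]
    · change (q j ⊗ₘ q j) ≫ m ≫ f = _
      rw [reassoc_of% hm, hf, IsMonHom.mul_hom, tensorHom_comp_tensorHom_assoc, hf]
  choose d hd using h_desc
  refine ⟨c, ⟨?_⟩, hc⟩
  exact
    { desc := d
      fac s j := by
        ext
        exact hd s j
      uniq s f hf := by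
        ext
        refine ext fun j ↦ ?_
        rw [hd]
        exact congr_arg Mon.Hom.hom (hf j) }

omit F in
lemma hasColimitsOfShape_of_isSifted [HasColimitsOfShape J C] : HasColimitsOfShape J (Mon C) where
  has_colimit F := by
    obtain ⟨c, ⟨hc⟩, _⟩ := exists_isColimit_of_isSifted hl hr F
    exact ⟨⟨⟨c, hc⟩⟩⟩

omit F in
lemma preservesColimitsOfShape_forget_of_isSifted [HasColimitsOfShape J C] :
    PreservesColimitsOfShape J (Mon.forget C) where
  preservesColimit {F} := by
    obtain ⟨c, ⟨hc⟩, ⟨hc'⟩⟩ := exists_isColimit_of_isSifted hl hr F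
    exact preservesColimit_of_preserves_colimit_cocone hc hc'

end

end Mon

end CategoryTheory

/-! ### Monadicity, colimits and local presentability of monoids. -/

namespace CategoryTheory

section

variable {C : Type*} [Category* C] {D : Type*} [Category* D] {F : C ⥤ D} {U : D ⥤ C}
  (adj : F ⊣ U) (h : ∀ X, RegularEpi (adj.counit.app X)) {J : Type*} [Category* J]

/-- If the counit of an adjunction consists of regular epimorphisms, so does the counit of the
induced adjunction between functor categories. -/
noncomputable def Adjunction.regularEpiCounitWhiskerRight (X : J ⥤ D) :
    RegularEpi ((adj.whiskerRight J).counit.app X) where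
  W := (((X ⋙ U) ⋙ F) ⋙ U) ⋙ F
  -- The canonical pair `FUFUX ⇉ FUX`; evaluated at each `j` it is the fork known to be a
  -- coequalizer from `h`.
  left := Functor.whiskerRight (Functor.whiskerRight ((adj.whiskerRight J).counit.app X) U) F
  right := (adj.whiskerRight J).counit.app ((X ⋙ U) ⋙ F)
  w := (adj.whiskerRight J).counit_naturality ((adj.whiskerRight J).counit.app X)
  isColimit := evaluationJointlyReflectsColimits _ fun j ↦ by
    refine (isColimitMapCoconeCoforkEquiv _ _).symm ?_
    refine IsColimit.equivOfNatIsoOfIso ?_ _ _ ?_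
      (LiftLeftAdjoint.counitCoequalises adj h (X.obj j))
    · exact parallelPair.ext (Iso.refl _) (Iso.refl _) (by simp) (by simp)
    · exact Cofork.ext (Iso.refl _) (by simp [Cofork.π])

include adj h in
-- Colimits of shape `J` amount to a left adjoint of the constant-diagram functor. After composition
-- with `U` objectwise one exists, built from `F` and colimits in `C`; the adjoint triangle theorem
-- lifts it.
lemma Adjunction.hasColimitsOfShape_of_regularEpi_counit [HasReflexiveCoequalizers D]
    [HasColimitsOfShape J C] : HasColimitsOfShape J D := by
  rw [hasColimitsOfShape_iff_isRightAdjoint_const]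
  have : (Functor.const J : C ⥤ _).IsRightAdjoint :=
    hasColimitsOfShape_iff_isRightAdjoint_const.1 inferInstance
  have : U.IsRightAdjoint := adj.isRightAdjoint
  have : ((Functor.const J : D ⥤ _) ⋙
      (Functor.whiskeringRight J D C).obj U).IsRightAdjoint :=
    Functor.isRightAdjoint_of_iso (F := U ⋙ (Functor.const J : C ⥤ _))
      (NatIso.ofComponents (fun X ↦ NatIso.ofComponents (fun j ↦ Iso.refl _)
        (fun f ↦ by simp)) (fun f ↦ by ext; simp))
  exact isRightAdjoint_triangle_lift (Functor.const J) (adj.whiskerRight J)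
    (adj.regularEpiCounitWhiskerRight h)

end

lemma Monad.hasColimitsOfShape_algebra {C : Type*} [Category* C] (T : Monad C)
    {J : Type*} [Category* J] [HasReflexiveCoequalizers T.Algebra] [HasColimitsOfShape J C] :
    HasColimitsOfShape J T.Algebra :=
  T.adj.hasColimitsOfShape_of_regularEpi_counit (fun X ↦ by
    rw [Monad.adj_counit]
    exact ⟨_, _, _, _, Monad.beckAlgebraCoequalizer X⟩)

lemma Monad.preservesColimitOfIsReflexivePair {C : Type*} {D : Type*} [Category.{v} C]
    [Category.{v} D] (G : C ⥤ D) [PreservesColimitsOfShape WalkingReflexivePair G] :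
    Monad.PreservesColimitOfIsReflexivePair G where
  out A B f g _ := by
    have : PreservesColimit (WalkingParallelPair.inclusionWalkingReflexivePair ⋙
        ofIsReflexivePair f g) G := inferInstance
    exact preservesColimit_of_iso_diagram G
      (inclusionWalkingReflexivePairOfIsReflexivePairIso f g)

namespace Mon

variable {C : Type u} [Category.{v} C] [MonoidalCategory C]
  (hl : ∀ X : C, (tensorLeft X).IsLeftAdjoint) (hr : ∀ X : C, (tensorRight X).IsLeftAdjoint)

include hl hr

lemma isEquivalence_comparison [HasColimitsOfShape WalkingReflexivePair C]
    {F : C ⥤ Mon C} (adj : F ⊣ Mon.forget C) : (Monad.comparison adj).IsEquivalence := by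
  have := hasColimitsOfShape_of_isSifted hl hr (J := WalkingReflexivePair)
  have := preservesColimitsOfShape_forget_of_isSifted hl hr (J := WalkingReflexivePair)
  have : HasReflexiveCoequalizers (Mon C) := hasReflexiveCoequalizers_iff.1 inferInstance
  have := Monad.preservesColimitOfIsReflexivePair (Mon.forget C)
  exact (Monad.monadicOfHasPreservesReflexiveCoequalizersOfReflectsIsomorphisms adj).eqv

lemma hasColimitsOfShape [HasColimitsOfShape WalkingReflexivePair C] {J : Type*} [Category* J]
    [HasColimitsOfShape J C] {F : C ⥤ Mon C} (adj : F ⊣ Mon.forget C) :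
    HasColimitsOfShape J (Mon C) := by
  have := isEquivalence_comparison hl hr adj
  have := hasColimitsOfShape_of_isSifted hl hr (J := WalkingReflexivePair)
  have : HasColimitsOfShape WalkingReflexivePair adj.toMonad.Algebra :=
    Adjunction.hasColimitsOfShape_of_equivalence (Monad.comparison adj).inv
  have : HasReflexiveCoequalizers adj.toMonad.Algebra :=
    hasReflexiveCoequalizers_iff.1 inferInstance
  have := adj.toMonad.hasColimitsOfShape_algebra (J := J)
  exact Adjunction.hasColimitsOfShape_of_equivalence (Monad.comparison adj)

lemma preservesColimitsOfShape_forget_of_isFiltered {J : Type*} [Category* J]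
    [IsFiltered J] [HasColimitsOfShape J C] : PreservesColimitsOfShape J (Mon.forget C) := by
  have := IsFiltered.isSifted (C := J)
  exact preservesColimitsOfShape_forget_of_isSifted hl hr

lemma isLocallyPresentable [IsLocallyPresentable.{v} C] {F : C ⥤ Mon C} (adj : F ⊣ Mon.forget C) :
    IsLocallyPresentable.{v} (Mon C) := by
  obtain ⟨κ, _, _⟩ := IsLocallyPresentable.exists_cardinal.{v} C
  have : HasColimitsOfSize.{v, v} (Mon C) :=
    ⟨fun J _ ↦ hasColimitsOfShape hl hr adj⟩
  exact isLocallyPresentable_of_adjunction adj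
    (fun J _ _ ↦ preservesColimitsOfShape_forget_of_isFiltered hl hr)

end Mon

end CategoryTheory

/-! ### Extending an action of `A` to an action of `B` by a sequential colimit. -/

namespace CategoryTheory

lemma MorphismProperty.transfiniteCompositionsOfShape_nat {C : Type*} [Category* C]
    (W : MorphismProperty C) {F : ℕ ⥤ C} {c : Cocone F} (hc : IsColimit c)
    (h : ∀ n, W (F.map (homOfLE (Nat.le_succ n)))) :
    W.transfiniteCompositionsOfShape ℕ (c.ι.app 0) :=
  ⟨{ F := F
     isoBot := Iso.refl _
     incl := c.ι
     isColimit := hc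
     fac := Category.id_comp _
     map_mem n _ := h n }⟩

/-- The functor `G` is quantified after `Q` because the same colimit is used below under `V`, `V ⋙
tensorLeft A` and `V ⋙ tensorLeft B`. -/
lemma exists_sequential_colimit {C : Type*} {L : Type*} [Category* C] [Category* L]
    [HasColimitsOfShape ℕ L]
    {M : ℕ → L} (k : ∀ n, M n ⟶ M (n + 1)) :
    ∃ (Q : L) (q : ∀ n, M n ⟶ Q),
      (∀ n, k n ≫ q (n + 1) = q n) ∧
      (∀ {Z : L} (f : ∀ n, M n ⟶ Z), (∀ n, k n ≫ f (n + 1) = f n) →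
        ∃ g : Q ⟶ Z, ∀ n, q n ≫ g = f n) ∧
      (∀ (G : L ⥤ C) [PreservesColimitsOfShape ℕ G],
        (∀ {Z : C} (f : ∀ n, G.obj (M n) ⟶ Z), (∀ n, G.map (k n) ≫ f (n + 1) = f n) →
          ∃ g : G.obj Q ⟶ Z, ∀ n, G.map (q n) ≫ g = f n) ∧
        (∀ {Z : C} (f g : G.obj Q ⟶ Z), (∀ n, G.map (q n) ≫ f = G.map (q n) ≫ g) → f = g) ∧
        ∀ (W : MorphismProperty C), (∀ n, W (G.map (k n))) →
          W.transfiniteCompositionsOfShape ℕ (G.map (q 0))) := by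
  let D : ℕ ⥤ L := Functor.ofSequence k
  have hD (n : ℕ) : D.map (homOfLE (Nat.le_add_right n 1)) = k n :=
    Functor.ofSequence_map_homOfLE_succ _ _
  let c : Cocone D := colimit.cocone D
  have hc : IsColimit c := colimit.isColimit D
  refine ⟨c.pt, c.ι.app, fun n ↦ ?_, fun {Z} f hf ↦ ?_, fun G _ ↦ ?_⟩
  · rw [← hD]
    exact c.w _
  · let t : Cocone D := Cocone.mk Z (NatTrans.ofSequence f (fun n ↦ by
      rw [hD]
      exact (hf n).trans (Category.comp_id _).symm))
    exact ⟨hc.desc t, hc.fac t⟩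
  · have hc' := isColimitOfPreserves G hc
    refine ⟨fun {Z} f hf ↦ ?_, fun f g h ↦ hc'.hom_ext h, fun W h ↦ ?_⟩
    · let t : Cocone (D ⋙ G) := Cocone.mk Z (NatTrans.ofSequence f (fun n ↦ by
        rw [Functor.comp_map, hD]
        exact (hf n).trans (Category.comp_id _).symm))
      exact ⟨hc'.desc t, hc'.fac t⟩
    · refine W.transfiniteCompositionsOfShape_nat hc' (fun n ↦ ?_)
      rw [Functor.comp_map, hD]
      exact h n

section Extension

variable {C : Type u} [Category.{v} C] [MonoidalCategory C] [HasPushouts C]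

/-- The pushout-product of two morphisms, as a morphism. -/
noncomputable abbrev pushoutProdMap {A B N M : C} (j : A ⟶ B) (m : N ⟶ M) :
    (Functor.PushoutObjObj.ofHasPushout (curriedTensor C) j m).pt ⟶ B ⊗ M :=
  (Functor.PushoutObjObj.ofHasPushout (curriedTensor C) j m).ι

/-- A morphism `m : N ⟶ V.obj M` such that the action of `A` on `V.obj M` is partially extended
to an action of `B`, over an object `P` on which `B` acts. -/
structure PartialExtension {L : Type*} [Category* L] (V : L ⥤ C) {A B : C} (j : A ⟶ B)
    (act : ∀ M : L, A ⊗ V.obj M ⟶ V.obj M) {P : L} (actP : B ⊗ V.obj P ⟶ V.obj P)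
    (R : MorphismProperty C) where
  /-- the domain of the extension -/
  N : C
  /-- the object on which `A` acts -/
  M : L
  /-- the inclusion of the domain -/
  m : N ⟶ V.obj M
  mem : R m
  /-- the partial action of `B` -/
  b : B ⊗ N ⟶ V.obj M
  /-- the projection to `P` -/
  p : M ⟶ P
  whiskerRight_comp_b : j ▷ N ≫ b = A ◁ m ≫ act M
  b_comp_map_p : b ≫ V.map p = B ◁ m ≫ B ◁ V.map p ≫ actP

namespace PartialExtension

variable {L : Type*} [Category.{v} L] {Fr : C ⥤ L} {V : L ⥤ C} (adj : Fr ⊣ V) [HasPushouts L]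
  {A B : C} {j : A ⟶ B} {act : ∀ M : L, A ⊗ V.obj M ⟶ V.obj M}
  (hact : ∀ {M M' : L} (f : M ⟶ M'), A ◁ V.map f ≫ act M' = act M ≫ V.map f)
  {P : L} {actP : B ⊗ V.obj P ⟶ V.obj P} (hP : j ▷ V.obj P ≫ actP = act P)
  {R : MorphismProperty C}

include adj hact hP in
-- The partial action of `B` and the full action of `A` glue to a map from the source of `j □ m` to
-- `M`. Pushing out the free object along it creates, universally, an action of `B` on all of `M`
-- with values in the larger `M'`.
lemma exists_step (s : PartialExtension V j act actP R) :
    ∃ (M' : L) (i : s.M ⟶ M') (b' : B ⊗ V.obj s.M ⟶ V.obj M') (p' : M' ⟶ P),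
      j ▷ V.obj s.M ≫ b' = A ◁ V.map i ≫ act M' ∧
      B ◁ s.m ≫ b' = s.b ≫ V.map i ∧
      b' ≫ V.map p' = B ◁ V.map i ≫ B ◁ V.map p' ≫ actP ∧
      i ≫ p' = s.p ∧
      ∃ (u : Fr.obj _ ⟶ s.M) (r : Fr.obj _ ⟶ M'),
        IsPushout u (Fr.map (pushoutProdMap j s.m)) i r := by
  let sq := Functor.PushoutObjObj.ofHasPushout (curriedTensor C) j s.m
  have inl_ι : sq.inl ≫ pushoutProdMap j s.m = B ◁ s.m := sq.inl_ι
  have inr_ι : sq.inr ≫ pushoutProdMap j s.m = j ▷ V.obj s.M := sq.inr_ι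
  obtain ⟨u₀, hu₀, hu₀'⟩ : ∃ u₀ : sq.pt ⟶ V.obj s.M, sq.inl ≫ u₀ = s.b ∧ sq.inr ≫ u₀ = act s.M :=
    ⟨sq.isPushout.desc s.b (act s.M) s.whiskerRight_comp_b, sq.isPushout.inl_desc _ _ _,
      sq.isPushout.inr_desc _ _ _⟩
  let u : Fr.obj sq.pt ⟶ s.M := (adj.homEquiv _ _).symm u₀
  have hu : adj.homEquiv _ _ u = u₀ := Equiv.apply_symm_apply _ _
  let i := pushout.inl u (Fr.map (pushoutProdMap j s.m))
  let r := pushout.inr u (Fr.map (pushoutProdMap j s.m))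
  have sq' : IsPushout u (Fr.map (pushoutProdMap j s.m)) i r := IsPushout.of_hasPushout _ _
  let b' : B ⊗ V.obj s.M ⟶ V.obj (pushout u (Fr.map (pushoutProdMap j s.m))) := adj.homEquiv _ _ r
  have hb' : pushoutProdMap j s.m ≫ b' = u₀ ≫ V.map i := by
    rw [← adj.homEquiv_naturality_left, ← sq'.w, adj.homEquiv_naturality_right, hu]
  let w : Fr.obj (B ⊗ V.obj s.M) ⟶ P := (adj.homEquiv _ _).symm (B ◁ V.map s.p ≫ actP)
  have hw : adj.homEquiv _ _ w = B ◁ V.map s.p ≫ actP := Equiv.apply_symm_apply _ _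
  have huw : u ≫ s.p = Fr.map (pushoutProdMap j s.m) ≫ w := by
    apply (adj.homEquiv _ _).injective
    rw [adj.homEquiv_naturality_left, hw, adj.homEquiv_naturality_right, hu]
    apply sq.isPushout.hom_ext
    · rw [reassoc_of% hu₀, s.b_comp_map_p, reassoc_of% inl_ι]
    · rw [reassoc_of% hu₀', reassoc_of% inr_ι, ← whisker_exchange_assoc, hP, hact]
  have hi : i ≫ sq'.desc s.p w huw = s.p := sq'.inl_desc _ _ _
  refine ⟨_, i, b', sq'.desc s.p w huw, ?_, ?_, ?_, hi, u, r, sq'⟩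
  · rw [hact, ← hu₀', Category.assoc, ← hb', reassoc_of% inr_ι]
  · rw [← hu₀, Category.assoc, ← hb', reassoc_of% inl_ι]
  · rw [← MonoidalCategory.whiskerLeft_comp_assoc, ← V.map_comp, hi, ← hw,
      ← adj.homEquiv_naturality_right, sq'.inr_desc]

include adj hact hP in
lemma exists_extension [HasColimitsOfShape ℕ L] [PreservesColimitsOfShape ℕ V]
    [PreservesColimitsOfShape WalkingSpan V]
    [PreservesColimitsOfShape ℕ (tensorLeft A)] [PreservesColimitsOfShape ℕ (tensorLeft B)]
    (W : MorphismProperty C) [R.IsStableUnderCobaseChange] [W.IsStableUnderCobaseChange]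
    (hR : ∀ {N M : C} (m : N ⟶ M), R m → R (V.map (Fr.map (pushoutProdMap j m))))
    (hW : ∀ {N M : C} (m : N ⟶ M), R m → W (V.map (Fr.map (pushoutProdMap j m))))
    (s : PartialExtension V j act actP R) :
    ∃ (Q : L) (i : s.M ⟶ Q) (p : Q ⟶ P) (b : B ⊗ V.obj Q ⟶ V.obj Q),
      j ▷ V.obj Q ≫ b = act Q ∧ b ≫ V.map p = B ◁ V.map p ≫ actP ∧ i ≫ p = s.p ∧
        W.transfiniteCompositionsOfShape ℕ (V.map i) := by
  choose M' i b' p' h₁ h₂ h₃ h₄ u r sq using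
    exists_step (R := R) adj hact hP
  have sq' (s) := (sq s).map V
  -- The new domain is the old object, and the new inclusion is a cobase change of the image of `j □
  -- m`; `hR` is what keeps it in `R`.
  let next (s : PartialExtension V j act actP R) : PartialExtension V j act actP R :=
    { N := V.obj s.M
      M := M' s
      m := V.map (i s)
      mem := R.of_isPushout (sq' s) (hR _ s.mem)
      b := b' s
      p := p' s
      whiskerRight_comp_b := h₁ s
      b_comp_map_p := h₃ s }
  let it (n : ℕ) : PartialExtension V j act actP R := Nat.rec s (fun _ ↦ next) n
  let M (n : ℕ) : L := (it n).M
  let k (n : ℕ) : M n ⟶ M (n + 1) := i (it n)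
  obtain ⟨Q, q, hq, desc, hV⟩ := exists_sequential_colimit (C := C) k
  obtain ⟨-, -, hW'⟩ := hV V
  obtain ⟨-, extA, -⟩ := hV (V ⋙ tensorLeft A)
  obtain ⟨descB, extB, -⟩ := hV (V ⋙ tensorLeft B)
  obtain ⟨p, hp⟩ := desc (fun n ↦ (it n).p) (fun n ↦ h₄ (it n))
  let bn (n : ℕ) : B ⊗ V.obj (M n) ⟶ V.obj (M (n + 1)) := b' (it n)
  have hbn (n : ℕ) : B ◁ V.map (k n) ≫ bn (n + 1) = bn n ≫ V.map (k (n + 1)) := h₂ (it (n + 1))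
  -- Each partial action moves up one stage; in the colimit this shift disappears and `B` acts on
  -- `Q` itself.
  obtain ⟨b, hb⟩ : ∃ b : B ⊗ V.obj Q ⟶ V.obj Q,
      ∀ n, B ◁ V.map (q n) ≫ b = bn n ≫ V.map (q (n + 1)) :=
    descB (fun n ↦ bn n ≫ V.map (q (n + 1))) (fun n ↦ by
      change B ◁ V.map (k n) ≫ _ = _
      rw [reassoc_of% (hbn n), ← V.map_comp, hq (n + 1)])
  refine ⟨Q, q 0, p, b, extA _ _ fun n ↦ ?_, extB _ _ fun n ↦ ?_, hp 0, hW' W fun n ↦ ?_⟩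
  · change A ◁ V.map (q n) ≫ _ = A ◁ V.map (q n) ≫ _
    have : j ▷ V.obj (M n) ≫ bn n = A ◁ V.map (k n) ≫ act (M (n + 1)) := h₁ (it n)
    rw [whisker_exchange_assoc, hb, reassoc_of% this, hact, ← hact (q (n + 1)),
      ← MonoidalCategory.whiskerLeft_comp_assoc, ← V.map_comp, hq n, hact]
  · change B ◁ V.map (q n) ≫ _ = B ◁ V.map (q n) ≫ _
    have : bn n ≫ V.map (it (n + 1)).p = B ◁ V.map (k n) ≫ B ◁ V.map (it (n + 1)).p ≫ actP :=
      h₃ (it n)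
    rw [reassoc_of% (hb n), ← V.map_comp, hp, this, ← MonoidalCategory.whiskerLeft_comp_assoc,
      ← MonoidalCategory.whiskerLeft_comp_assoc, ← V.map_comp, ← V.map_comp, hp]
    congr 3
    exact h₄ (it n)
  · exact W.of_isPushout (sq' (it n)) (hW _ (it n).mem)

end PartialExtension

end Extension

end CategoryTheory

/-! ### The monoid of equivariant endomorphisms over a monoid. -/

namespace CategoryTheory

variable {C : Type u} [Category.{v} C] [MonoidalCategory C]

open scoped CategoryTheory.MonObj

/-- The universal object acting on `Q` and mapping to the monoid `P`, in such a way that the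
morphism `p : Q ⟶ P` is equivariant. -/
structure EquivariantEnd {P Q : C} [MonObj P] (p : Q ⟶ P) where
  /-- the universal object -/
  E : C
  /-- the action -/
  x : E ⊗ Q ⟶ Q
  /-- the projection -/
  t : E ⟶ P
  w : x ≫ p = E ◁ p ≫ t ▷ P ≫ μ[P]
  exists_lift {Z : C} (a : Z ⊗ Q ⟶ Q) (s : Z ⟶ P) (h : a ≫ p = Z ◁ p ≫ s ▷ P ≫ μ[P]) :
    ∃ z : Z ⟶ E, z ▷ Q ≫ x = a ∧ z ≫ t = s
  hom_ext {Z : C} (z z' : Z ⟶ E) (hx : z ▷ Q ≫ x = z' ▷ Q ≫ x) (ht : z ≫ t = z' ≫ t) : z = z'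

namespace EquivariantEnd

/-- With `H` right adjoint to `- ⊗ Q`, take the pullback of `H Q ⟶ H P` along the map `P ⟶ H P`
which is the transpose of left multiplication on the image of `p`. -/
lemma nonempty [HasPullbacks C] (hr : ∀ X : C, (tensorRight X).IsLeftAdjoint)
    {P Q : C} [MonObj P] (p : Q ⟶ P) : Nonempty (EquivariantEnd p) := by
  have := hr Q
  let adj : tensorRight Q ⊣ (tensorRight Q).rightAdjoint :=
    Adjunction.ofIsLeftAdjoint (tensorRight Q)
  obtain ⟨H, adj⟩ : ∃ H, Nonempty (tensorRight Q ⊣ H) := ⟨_, ⟨adj⟩⟩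
  obtain ⟨adj⟩ := adj
  let e (Z Y : C) : (Z ⊗ Q ⟶ Y) ≃ (Z ⟶ H.obj Y) := adj.homEquiv Z Y
  have e₁ {Z Z' Y : C} (f : Z ⟶ Z') (g : Z' ⊗ Q ⟶ Y) : e _ _ (f ▷ Q ≫ g) = f ≫ e _ _ g :=
    adj.homEquiv_naturality_left f g
  have e₂ {Z Y Y' : C} (f : Z ⊗ Q ⟶ Y) (g : Y ⟶ Y') : e _ _ (f ≫ g) = e _ _ f ≫ H.map g :=
    adj.homEquiv_naturality_right f g
  let r : P ⟶ H.obj P := e _ _ (P ◁ p ≫ μ[P])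
  let E := pullback (H.map p) r
  let x : E ⊗ Q ⟶ Q := (e _ _).symm (pullback.fst _ _)
  have hx : e _ _ x = pullback.fst (H.map p) r := Equiv.apply_symm_apply _ _
  refine ⟨⟨E, x, pullback.snd _ _, ?_, fun {Z} a s h ↦ ?_, fun {Z} z z' h₁ h₂ ↦ ?_⟩⟩
  · apply (e _ _).injective
    rw [e₂, hx, pullback.condition, whisker_exchange_assoc, e₁]
  · have h' : e _ _ a ≫ H.map p = s ≫ r := by
      rw [← e₂, h, ← e₁, whisker_exchange_assoc]
    refine ⟨pullback.lift _ _ h', (e _ _).injective ?_, pullback.lift_snd _ _ _⟩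
    rw [e₁, hx, pullback.lift_fst]
  · apply pullback.hom_ext
    · rw [← hx, ← e₁, ← e₁, h₁]
    · exact h₂

variable {P Q : C} [MonObj P] {p : Q ⟶ P} (d : EquivariantEnd p)

lemma exists_one : ∃ one : 𝟙_ C ⟶ d.E, one ▷ Q ≫ d.x = (λ_ Q).hom ∧ one ≫ d.t = η[P] :=
  d.exists_lift _ _ (by simp)

lemma exists_mul : ∃ mul : d.E ⊗ d.E ⟶ d.E,
    mul ▷ Q ≫ d.x = (α_ _ _ _).hom ≫ d.E ◁ d.x ≫ d.x ∧
    mul ≫ d.t = (d.t ⊗ₘ d.t) ≫ μ[P] := by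
  refine d.exists_lift _ _ ?_
  rw [Category.assoc, Category.assoc, d.w, ← MonoidalCategory.whiskerLeft_comp_assoc, d.w,
    MonoidalCategory.tensorHom_def']
  simp only [MonoidalCategory.whiskerLeft_comp, comp_whiskerRight, Category.assoc,
    MonObj.mul_assoc, whisker_assoc, tensor_whiskerLeft, whisker_exchange_assoc,
    associator_naturality_left_assoc]
  have h₁ : (α_ d.E d.E Q).hom ≫ d.E ◁ d.E ◁ p ≫ (α_ d.E d.E P).inv = (d.E ⊗ d.E) ◁ p := by simp
  have h₂ : P ◁ d.t ▷ Q ≫ P ◁ P ◁ p = P ◁ d.E ◁ p ≫ P ◁ d.t ▷ P := by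
    rw [← MonoidalCategory.whiskerLeft_comp, ← MonoidalCategory.whiskerLeft_comp, whisker_exchange]
  rw [reassoc_of% h₁, reassoc_of% h₂, associator_naturality_right_assoc, Iso.inv_hom_id_assoc,
    whisker_exchange_assoc]

/-- Composition of endomorphisms. Each monoid axiom is checked after acting on `Q` and after
projecting to `P`, which is enough by `hom_ext`. -/
lemma exists_monObj : ∃ _ : MonObj d.E,
    (η[d.E] ▷ Q ≫ d.x = (λ_ Q).hom ∧ η[d.E] ≫ d.t = η[P]) ∧
    μ[d.E] ▷ Q ≫ d.x = (α_ _ _ _).hom ≫ d.E ◁ d.x ≫ d.x ∧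
    μ[d.E] ≫ d.t = (d.t ⊗ₘ d.t) ≫ μ[P] := by
  obtain ⟨one, h₁, h₁'⟩ := d.exists_one
  obtain ⟨mul, h₂, h₂'⟩ := d.exists_mul
  refine ⟨{ one := one, mul := mul, one_mul := ?_, mul_one := ?_, mul_assoc := ?_ },
    ⟨h₁, h₁'⟩, h₂, h₂'⟩
  · apply d.hom_ext
    · rw [comp_whiskerRight_assoc, h₂, associator_naturality_left_assoc,
        ← whisker_exchange_assoc, h₁]
      simp
    · rw [Category.assoc, h₂', MonoidalCategory.tensorHom_def_assoc, ← comp_whiskerRight_assoc,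
        h₁', ← whisker_exchange_assoc, MonObj.one_mul, leftUnitor_naturality]
  · apply d.hom_ext
    · rw [comp_whiskerRight_assoc, h₂, associator_naturality_middle_assoc,
        ← MonoidalCategory.whiskerLeft_comp_assoc, h₁]
      simp
    · rw [Category.assoc, h₂', MonoidalCategory.tensorHom_def'_assoc,
        ← MonoidalCategory.whiskerLeft_comp_assoc, h₁', whisker_exchange_assoc, MonObj.mul_one,
        rightUnitor_naturality]
  · apply d.hom_ext
    · simp only [comp_whiskerRight, Category.assoc, h₂]
      rw [associator_naturality_left_assoc,
        ← whisker_exchange_assoc, h₂, associator_naturality_middle_assoc,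
        ← MonoidalCategory.whiskerLeft_comp_assoc, h₂]
      simp
    · simp only [Category.assoc, h₂']
      have h₃ : mul ▷ d.E ≫ (d.t ⊗ₘ d.t) = ((d.t ⊗ₘ d.t) ⊗ₘ d.t) ≫ μ[P] ▷ P := by
        rw [← tensorHom_id, ← tensorHom_id, tensorHom_comp_tensorHom, tensorHom_comp_tensorHom, h₂',
          Category.id_comp, Category.comp_id]
      have h₄ : d.E ◁ mul ≫ (d.t ⊗ₘ d.t) = (d.t ⊗ₘ (d.t ⊗ₘ d.t)) ≫ P ◁ μ[P] := by
        rw [← id_tensorHom, ← id_tensorHom, tensorHom_comp_tensorHom, tensorHom_comp_tensorHom, h₂',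
          Category.id_comp, Category.comp_id]
      rw [reassoc_of% h₃, reassoc_of% h₄, ← associator_naturality_assoc, MonObj.mul_assoc]

/-- A morphism of monoids to a pushout in the category of monoids is a retract of any suitable
equivariant morphism. -/
lemma exists_section_of_equivariant (hr : ∀ X : C, (tensorRight X).IsLeftAdjoint) [HasPullbacks C]
    {X P : Mon C} (ψ : X ⟶ P) {A B : C} {j : A ⟶ B} {α : A ⟶ X.X} {β : B ⟶ P.X}
    (hβ : j ≫ β = α ≫ ψ.hom)
    (desc : ∀ {M : Mon C} (f : X ⟶ M) (g : B ⟶ M.X), j ≫ g = α ≫ f.hom →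
      ∃ θ : P ⟶ M, ψ ≫ θ = f ∧ β ≫ θ.hom = g)
    (ext : ∀ {M : Mon C} (f g : P ⟶ M), ψ ≫ f = ψ ≫ g → β ≫ f.hom = β ≫ g.hom → f = g)
    {Q : C} (a : X.X ⊗ Q ⟶ Q) (one_a : η[X.X] ▷ Q ≫ a = (λ_ Q).hom)
    (mul_a : μ[X.X] ▷ Q ≫ a = (α_ _ _ _).hom ≫ X.X ◁ a ≫ a)
    (b : B ⊗ Q ⟶ Q) (hb : j ▷ Q ≫ b = α ▷ Q ≫ a)
    (p : Q ⟶ P.X) (ha : a ≫ p = X.X ◁ p ≫ ψ.hom ▷ P.X ≫ μ[P.X])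
    (hb' : b ≫ p = B ◁ p ≫ β ▷ P.X ≫ μ[P.X])
    (i : X.X ⟶ Q) (hi : μ[X.X] ≫ i = X.X ◁ i ≫ a) (hip : i ≫ p = ψ.hom) :
    ∃ φ : P.X ⟶ Q, ψ.hom ≫ φ = i ∧ φ ≫ p = 𝟙 _ := by
  obtain ⟨d⟩ := EquivariantEnd.nonempty hr p
  obtain ⟨_, ⟨h₁, h₁'⟩, h₂, h₂'⟩ := d.exists_monObj
  obtain ⟨f₀, hf₀, hf₀'⟩ := d.exists_lift a ψ.hom ha
  obtain ⟨g, hg, hg'⟩ := d.exists_lift b β hb'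
  let f : X ⟶ Mon.mk d.E := Mon.Hom.mk' f₀
    (d.hom_ext _ _ (by rw [comp_whiskerRight_assoc, hf₀, h₁, one_a])
      (by rw [Category.assoc, hf₀', h₁', IsMonHom.one_hom]))
    (d.hom_ext _ _ (by
        rw [comp_whiskerRight_assoc, hf₀, mul_a, comp_whiskerRight_assoc, h₂,
          MonoidalCategory.tensorHom_def, comp_whiskerRight_assoc,
          associator_naturality_middle_assoc, ← MonoidalCategory.whiskerLeft_comp_assoc, hf₀,
          associator_naturality_left_assoc, ← whisker_exchange_assoc, hf₀]) (by
        rw [Category.assoc, hf₀', Category.assoc, h₂', IsMonHom.mul_hom,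
          tensorHom_comp_tensorHom_assoc, hf₀']))
  let t : Mon.mk d.E ⟶ P := Mon.Hom.mk' d.t h₁' h₂'
  have hft : f ≫ t = ψ := by
    ext
    exact hf₀'
  -- The actions of `X` and `B` agree on `A`, so they induce a monoid morphism from the pushout `P`
  -- to `E`; uniqueness then shows that it is a section of the projection `t`.
  obtain ⟨θ, hθ, hθ'⟩ := desc f g (d.hom_ext _ _
    (by
      change (j ≫ g) ▷ Q ≫ d.x = (α ≫ f₀) ▷ Q ≫ d.x
      rw [comp_whiskerRight_assoc, hg, comp_whiskerRight_assoc, hf₀, hb])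
    (by
      change (j ≫ g) ≫ d.t = (α ≫ f₀) ≫ d.t
      rw [Category.assoc, hg', Category.assoc, hf₀', hβ]))
  have hθt : θ ≫ t = 𝟙 P := ext _ _ (by rw [reassoc_of% hθ, hft, Category.comp_id])
    (by
      change β ≫ θ.hom ≫ d.t = β ≫ 𝟙 _
      rw [reassoc_of% hθ', hg', Category.comp_id])
  have hθt' : θ.hom ≫ d.t = 𝟙 P.X := congr_arg Mon.Hom.hom hθt
  have hθf : ψ.hom ≫ θ.hom = f₀ := congr_arg Mon.Hom.hom hθ
  -- In elements, `φ y = θ y · i 1`. Then `φ (ψ x) = x · i 1 = i x`, and `p (φ y) = y · p (i 1) =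
  -- y`.
  let φ : P.X ⟶ Q := (ρ_ P.X).inv ≫ P.X ◁ (η[X.X] ≫ i) ≫ θ.hom ▷ Q ≫ d.x
  have hφ : φ = (ρ_ P.X).inv ≫ P.X ◁ (η[X.X] ≫ i) ≫ θ.hom ▷ Q ≫ d.x := rfl
  refine ⟨φ, ?_, ?_⟩
  · rw [hφ, rightUnitor_inv_naturality_assoc, ← whisker_exchange_assoc, ← comp_whiskerRight_assoc,
      hθf, hf₀, MonoidalCategory.whiskerLeft_comp_assoc, ← hi, MonObj.mul_one_assoc,
      Iso.inv_hom_id_assoc]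
  · have h₃ : P.X ◁ (η[X.X] ≫ i) ≫ P.X ◁ p = P.X ◁ η[P.X] := by
      rw [← MonoidalCategory.whiskerLeft_comp, Category.assoc, hip, IsMonHom.one_hom]
    rw [hφ, Category.assoc, Category.assoc, Category.assoc, d.w, ← whisker_exchange_assoc,
      ← comp_whiskerRight_assoc, hθt', id_whiskerRight, Category.id_comp, reassoc_of% h₃,
      MonObj.mul_one, Iso.inv_hom_id]

end EquivariantEnd

end CategoryTheory

/-! ### Pushout-products and the class of the monoid axiom. -/

namespace CategoryTheory

variable {C : Type u} [Category.{v} C] [MonoidalCategory C]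

/-- A map out of `B ⊗ M` is given by its restrictions to `B ⊗ N` and `B ⊗ L`; its compatibility on
`A ⊗ M` can be tested on `A ⊗ N` and `A ⊗ L`. So `j □ -` preserves cobase change. -/
lemma IsPushout.exists_isPushout_pushoutProdMap [HasPushouts C] {A B : C}
    [PreservesColimitsOfShape WalkingSpan (tensorLeft A)]
    [PreservesColimitsOfShape WalkingSpan (tensorLeft B)] (j : A ⟶ B) {K L N M : C}
    {a : K ⟶ N} {f : K ⟶ L} {m : N ⟶ M} {c : L ⟶ M} (h : IsPushout a f m c) :
    ∃ l, IsPushout l (pushoutProdMap j f) (pushoutProdMap j m) (B ◁ c) := by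
  have hA : IsPushout (A ◁ a) (A ◁ f) (A ◁ m) (A ◁ c) := h.map (tensorLeft A)
  have hB : IsPushout (B ◁ a) (B ◁ f) (B ◁ m) (B ◁ c) := h.map (tensorLeft B)
  let sq := Functor.PushoutObjObj.ofHasPushout (curriedTensor C) j f
  let sq' := Functor.PushoutObjObj.ofHasPushout (curriedTensor C) j m
  have inl_ι : sq.inl ≫ pushoutProdMap j f = B ◁ f := sq.inl_ι
  have inr_ι : sq.inr ≫ pushoutProdMap j f = j ▷ L := sq.inr_ι
  have inl_ι' : sq'.inl ≫ pushoutProdMap j m = B ◁ m := sq'.inl_ι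
  have inr_ι' : sq'.inr ≫ pushoutProdMap j m = j ▷ M := sq'.inr_ι
  have w : A ◁ f ≫ sq.inr = j ▷ K ≫ sq.inl := sq.isPushout.w.symm
  have w' : A ◁ m ≫ sq'.inr = j ▷ N ≫ sq'.inl := sq'.isPushout.w.symm
  obtain ⟨l, h₁, h₂⟩ : ∃ l : sq.pt ⟶ sq'.pt, sq.inl ≫ l = B ◁ a ≫ sq'.inl ∧
      sq.inr ≫ l = A ◁ c ≫ sq'.inr :=
    ⟨sq.isPushout.desc (B ◁ a ≫ sq'.inl) (A ◁ c ≫ sq'.inr) (by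
      change j ▷ K ≫ _ = A ◁ f ≫ _
      rw [← reassoc_of% hA.w, w', whisker_exchange_assoc]), sq.isPushout.inl_desc _ _ _,
      sq.isPushout.inr_desc _ _ _⟩
  refine ⟨l, ⟨⟨?_⟩, ⟨PushoutCocone.IsColimit.mk _
    (fun s ↦ hB.desc (sq'.inl ≫ s.inl) s.inr ?_) (fun s ↦ ?_) (fun s ↦ ?_) (fun s t h₃ h₄ ↦ ?_)⟩⟩⟩
  · apply sq.isPushout.hom_ext
    · rw [reassoc_of% h₁, inl_ι', hB.w, reassoc_of% inl_ι]
    · rw [reassoc_of% h₂, inr_ι', whisker_exchange, reassoc_of% inr_ι]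
  · rw [← reassoc_of% h₁, s.condition, reassoc_of% inl_ι]
  · apply sq'.isPushout.hom_ext
    · rw [reassoc_of% inl_ι', hB.inl_desc]
    · rw [reassoc_of% inr_ι']
      apply hA.hom_ext
      · rw [whisker_exchange_assoc, hB.inl_desc, reassoc_of% w']
      · rw [whisker_exchange_assoc, hB.inr_desc, ← reassoc_of% h₂, s.condition,
          reassoc_of% inr_ι]
  · exact hB.inr_desc _ _ _
  · apply hB.hom_ext
    · rw [hB.inl_desc, ← h₃, reassoc_of% inl_ι']
    · rw [hB.inr_desc, h₄]

section

variable [ModelCategory C]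

/-- The class of iterated pushout-products of trivial cofibrations and morphisms from an
initial object. -/
def iteratedPushoutProdClass : MorphismProperty C := fun _ _ f ↦
  ∃ (g : Arrow C) (l : List (Arrow C)),
    (∀ h ∈ g :: l, trivialCofibrations C h.hom ∨ Nonempty (IsInitial h.left)) ∧
    Nonempty (Arrow.mk f ≅ iteratedPushoutProd g l)

lemma monoidAxiomClass_le_iteratedPushoutProdClass :
    monoidAxiomClass C ≤ iteratedPushoutProdClass := by
  rintro _ _ f ⟨g, l, h, -, e⟩
  exact ⟨g, l, h, e⟩

lemma iteratedPushoutProdClass_of_isInitial {X Y : C} (f : X ⟶ Y) (hX : IsInitial X) :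
    iteratedPushoutProdClass f :=
  ⟨Arrow.mk f, [], by simpa using Or.inr ⟨hX⟩, ⟨Iso.refl _⟩⟩

/-- Tensoring on the right preserves initial objects, so two of the three corners in the source of
the pushout-product are initial and only `X ⊗ h.left` remains. -/
lemma nonempty_pushoutProd_iso_of_isInitial (hr : ∀ X : C, (tensorRight X).IsLeftAdjoint)
    {I X : C} (f : I ⟶ X) (hI : IsInitial I) (h : Arrow C) :
    Nonempty (pushoutProd (Arrow.mk f) h ≅ Arrow.mk (X ◁ h.hom)) := by
  have (Y : C) : PreservesColimitsOfShape (Discrete PEmpty.{1}) ((curriedTensor C).flip.obj Y) := by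
    have := hr Y
    exact inferInstanceAs (PreservesColimitsOfShape (Discrete PEmpty.{1}) (tensorRight Y))
  let e := Functor.PushoutObjObj.ι_iso_of_iso_left (f₁ := Arrow.mk f) (f₁' := Arrow.mk f) (f₂ := h)
    (Functor.PushoutObjObj.ofHasPushout (curriedTensor C) f h.hom)
    (Functor.PushoutObjObj.ofIsInitialLeft (curriedTensor C) f h.hom hI) (Iso.refl (Arrow.mk f))
  exact ⟨e⟩

/-- Prepend `∅ ⟶ X` and `j` to the list for `m`. The factor `j` is the required trivial cofibration,
so `m` need not contain one; this allows the iteration to start at a map out of `∅`. -/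
lemma monoidAxiomClass_whiskerLeft_pushoutProdMap (hr : ∀ X : C, (tensorRight X).IsLeftAdjoint)
    (X : C) {A B : C} (j : A ⟶ B) (hj : trivialCofibrations C j) {N M : C} (m : N ⟶ M)
    (hm : iteratedPushoutProdClass m) : monoidAxiomClass C (X ◁ pushoutProdMap j m) := by
  obtain ⟨g, l, hl, ⟨e⟩⟩ := hm
  refine ⟨Arrow.mk (initial.to X), Arrow.mk j :: g :: l, ?_, ⟨Arrow.mk j, by simp, hj⟩, ?_⟩
  · intro h hh
    rw [List.mem_cons, List.mem_cons] at hh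
    obtain rfl | rfl | hh := hh
    · exact Or.inr ⟨initialIsInitial⟩
    · exact Or.inl hj
    · exact hl h hh
  · let e₁ : Arrow.mk (pushoutProdMap j m) ≅ pushoutProd (Arrow.mk j) (iteratedPushoutProd g l) :=
      (MonoidalCategory.Arrow.pushoutProduct.obj (Arrow.mk j)).mapIso e
    obtain ⟨e₂⟩ := nonempty_pushoutProd_iso_of_isInitial hr (initial.to X) initialIsInitial
      (pushoutProd (Arrow.mk j) (iteratedPushoutProd g l))
    exact ⟨(tensorLeft X).mapArrow.mapIso e₁ ≪≫ e₂.symm⟩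

lemma monoidAxiomClass_pushouts_whiskerLeft_pushoutProdMap
    (hl : ∀ X : C, (tensorLeft X).IsLeftAdjoint) (hr : ∀ X : C, (tensorRight X).IsLeftAdjoint)
    (X : C) {A B : C} (j : A ⟶ B) (hj : trivialCofibrations C j) {N M : C} (m : N ⟶ M)
    (hm : (iteratedPushoutProdClass (C := C)).pushouts m) :
    (monoidAxiomClass C).pushouts (X ◁ pushoutProdMap j m) := by
  obtain ⟨K, L, f, a, c, hf, sq⟩ := hm
  have := hl A
  have := hl B
  have := hl X
  obtain ⟨_, sq'⟩ := sq.exists_isPushout_pushoutProdMap j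
  exact (monoidAxiomClass C).pushouts_mk (sq'.map (tensorLeft X))
    (monoidAxiomClass_whiskerLeft_pushoutProdMap hr X j hj f hf)

end

end CategoryTheory

/-! ### Modules over a monoid, and pushouts of monoids along free morphisms. -/

namespace CategoryTheory

variable {C : Type u} [Category.{v} C] [MonoidalCategory C]

/-- The monad whose algebras are the left modules over a monoid. -/
def MonObj.tensorLeftMonad (X : C) [MonObj X] : Monad C where
  toFunctor := tensorLeft X
  η :=
    { app Z := (λ_ Z).inv ≫ (MonObj.one (X := X)) ▷ Z
      naturality Y Z f := by
        change f ≫ (λ_ Z).inv ≫ _ ▷ Z = ((λ_ Y).inv ≫ _ ▷ Y) ≫ X ◁ f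
        rw [Category.assoc, ← whisker_exchange, leftUnitor_inv_naturality_assoc] }
  μ :=
    { app Z := (α_ X X Z).inv ≫ (MonObj.mul (X := X)) ▷ Z
      naturality Y Z f := by
        change X ◁ X ◁ f ≫ (α_ X X Z).inv ≫ _ ▷ Z = ((α_ X X Y).inv ≫ _ ▷ Y) ≫ X ◁ f
        rw [Category.assoc, ← whisker_exchange, associator_inv_naturality_right_assoc] }
  left_unit Z := by
    change ((λ_ (X ⊗ Z)).inv ≫ (MonObj.one (X := X)) ▷ (X ⊗ Z)) ≫
      (α_ X X Z).inv ≫ (MonObj.mul (X := X)) ▷ Z = 𝟙 (X ⊗ Z)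
    rw [Category.assoc, associator_inv_naturality_left_assoc, ← comp_whiskerRight, MonObj.one_mul]
    simp
  right_unit Z := by
    change X ◁ ((λ_ Z).inv ≫ (MonObj.one (X := X)) ▷ Z) ≫
      (α_ X X Z).inv ≫ (MonObj.mul (X := X)) ▷ Z = 𝟙 (X ⊗ Z)
    rw [MonoidalCategory.whiskerLeft_comp_assoc, associator_inv_naturality_middle_assoc,
      ← comp_whiskerRight, MonObj.mul_one]
    simp
  assoc Z := by
    change X ◁ ((α_ X X Z).inv ≫ (MonObj.mul (X := X)) ▷ Z) ≫
      (α_ X X Z).inv ≫ (MonObj.mul (X := X)) ▷ Z =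
      ((α_ X X (X ⊗ Z)).inv ≫ (MonObj.mul (X := X)) ▷ (X ⊗ Z)) ≫
        (α_ X X Z).inv ≫ (MonObj.mul (X := X)) ▷ Z
    rw [MonoidalCategory.whiskerLeft_comp_assoc, associator_inv_naturality_middle_assoc,
      ← comp_whiskerRight, Category.assoc, associator_inv_naturality_left_assoc,
      ← comp_whiskerRight, MonObj.mul_assoc]
    simp

open scoped CategoryTheory.MonObj

namespace MonObj

variable {X : C} [MonObj X] (M N : (tensorLeftMonad X).Algebra)

/-- The left action on a module. -/
def action : X ⊗ M.A ⟶ M.A := M.a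

lemma one_action : η[X] ▷ M.A ≫ action M = (λ_ M.A).hom := by
  have : ((λ_ M.A).inv ≫ η[X] ▷ M.A) ≫ action M = 𝟙 _ := M.unit
  rwa [Category.assoc, Iso.inv_comp_eq, Category.comp_id] at this

lemma mul_action : μ[X] ▷ M.A ≫ action M = (α_ _ _ _).hom ≫ X ◁ action M ≫ action M := by
  have : ((α_ X X M.A).inv ≫ μ[X] ▷ M.A) ≫ action M = X ◁ action M ≫ action M := M.assoc
  rwa [Category.assoc, Iso.inv_comp_eq] at this

variable {M N}

lemma action_comp (f : M ⟶ N) : action M ≫ f.f = X ◁ f.f ≫ action N := f.h.symm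

end MonObj

/-- A morphism of monoids makes its target a left module over its source. -/
def Mon.Hom.algebra {X P : Mon C} (ψ : X ⟶ P) : (MonObj.tensorLeftMonad X.X).Algebra where
  A := P.X
  a := ψ.hom ▷ P.X ≫ μ[P.X]
  unit := by
    change ((λ_ P.X).inv ≫ η[X.X] ▷ P.X) ≫ ψ.hom ▷ P.X ≫ μ[P.X] = 𝟙 _
    rw [Category.assoc, ← comp_whiskerRight_assoc, IsMonHom.one_hom, MonObj.one_mul,
      Iso.inv_hom_id]
  assoc := by
    change ((α_ X.X X.X P.X).inv ≫ μ[X.X] ▷ P.X) ≫ ψ.hom ▷ P.X ≫ μ[P.X] =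
      X.X ◁ (ψ.hom ▷ P.X ≫ μ[P.X]) ≫ ψ.hom ▷ P.X ≫ μ[P.X]
    rw [Category.assoc, Iso.inv_comp_eq, ← comp_whiskerRight_assoc, IsMonHom.mul_hom,
      MonoidalCategory.tensorHom_def, comp_whiskerRight_assoc, comp_whiskerRight_assoc,
      MonObj.mul_assoc, associator_naturality_middle_assoc, associator_naturality_left_assoc,
      MonoidalCategory.whiskerLeft_comp_assoc, whisker_exchange_assoc, whisker_exchange_assoc]

lemma MorphismProperty.of_comp_eq_of_section {C : Type*} [Category* C] (W : MorphismProperty C)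
    [W.IsStableUnderRetracts] {X Y Z : C} {f : X ⟶ Y} {i : X ⟶ Z} {s : Y ⟶ Z} {r : Z ⟶ Y}
    (h : f ≫ s = i) (hs : s ≫ r = 𝟙 Y) (hi : W i) : W f := by
  subst h
  let e : RetractArrow f (f ≫ s) :=
    { i := CategoryTheory.Arrow.homMk (u := 𝟙 X) (v := s) (w := Category.id_comp _)
      r := CategoryTheory.Arrow.homMk (u := 𝟙 X) (v := r) (w := by simp [hs])
      retract := by
        ext
        · simp
        · simp [hs] }
  exact W.of_retract e hi

/-- The underlying morphism of a morphism out of a monoid is in any weakly saturated class that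
contains the class of the monoid axiom, when it has the universal property of a pushout of
a morphism between the free monoids induced by a trivial cofibration. -/
lemma MorphismProperty.IsWeaklySaturated.of_isPushout_mon [ModelCategory C]
    [HasColimitsOfShape ℕ C]
    (hl : ∀ X : C, (tensorLeft X).IsLeftAdjoint) (hr : ∀ X : C, (tensorRight X).IsLeftAdjoint)
    {W : MorphismProperty C} (hW : W.IsWeaklySaturated) (hW' : monoidAxiomClass C ≤ W)
    {X P : Mon C} (ψ : X ⟶ P) {A B : C} {j : A ⟶ B} (hj : trivialCofibrations C j)
    {α : A ⟶ X.X} {β : B ⟶ P.X} (hβ : j ≫ β = α ≫ ψ.hom)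
    (desc : ∀ {M : Mon C} (f : X ⟶ M) (g : B ⟶ M.X), j ≫ g = α ≫ f.hom →
      ∃ θ : P ⟶ M, ψ ≫ θ = f ∧ β ≫ θ.hom = g)
    (ext : ∀ {M : Mon C} (f g : P ⟶ M), ψ ≫ f = ψ ≫ g → β ≫ f.hom = β ≫ g.hom → f = g) :
    W ψ.hom := by
  let T := MonObj.tensorLeftMonad X.X
  have := hl A
  have := hl B
  -- Since `X ⊗ -` preserves colimits, the forgetful functor from left `X`-modules creates them.
  have hT {J : Type} [SmallCategory J] : PreservesColimitsOfShape J T.toFunctor := by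
    have := hl X.X
    exact inferInstanceAs (PreservesColimitsOfShape J (tensorLeft X.X))
  have : HasPushouts T.Algebra :=
    hasColimitsOfShape_of_hasColimitsOfShape_createsColimitsOfShape T.forget
  have : HasColimitsOfShape ℕ T.Algebra :=
    hasColimitsOfShape_of_hasColimitsOfShape_createsColimitsOfShape T.forget
  let act (M : T.Algebra) : A ⊗ T.forget.obj M ⟶ T.forget.obj M := α ▷ M.A ≫ MonObj.action M
  have hact {M M' : T.Algebra} (f : M ⟶ M') :
      A ◁ T.forget.map f ≫ act M' = act M ≫ T.forget.map f := by
    change A ◁ f.f ≫ α ▷ M'.A ≫ MonObj.action M' = (α ▷ M.A ≫ MonObj.action M) ≫ f.f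
    rw [whisker_exchange_assoc, Category.assoc, MonObj.action_comp]
  let P' : T.Algebra := Mon.Hom.algebra ψ
  let X' : T.Algebra := Mon.Hom.algebra (𝟙 X)
  let ψ' : X' ⟶ P' :=
    { f := ψ.hom
      h := by
        change X.X ◁ ψ.hom ≫ ψ.hom ▷ P.X ≫ μ[P.X] = (𝟙 X.X ▷ X.X ≫ μ[X.X]) ≫ ψ.hom
        rw [id_whiskerRight, Category.id_comp, IsMonHom.mul_hom, tensorHom_def'_assoc] }
  let actP : B ⊗ T.forget.obj P' ⟶ T.forget.obj P' := β ▷ P.X ≫ μ[P.X]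
  have hP : j ▷ T.forget.obj P' ≫ actP = act P' := by
    change j ▷ P.X ≫ β ▷ P.X ≫ μ[P.X] = α ▷ P.X ≫ ψ.hom ▷ P.X ≫ μ[P.X]
    rw [← comp_whiskerRight_assoc, hβ, comp_whiskerRight_assoc]
  have hI (Z : C) : IsInitial (Z ⊗ ⊥_ C) := by
    have := hl Z
    exact IsInitial.isInitialObj (tensorLeft Z) _ initialIsInitial
  -- The iteration starts with `B` acting on nothing: the domain is `∅`, inside the regular module
  -- `X`.
  let s : PartialExtension T.forget j act actP (iteratedPushoutProdClass (C := C)).pushouts :=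
    { N := ⊥_ C
      M := X'
      m := initial.to _
      mem := MorphismProperty.le_pushouts _ _
        (iteratedPushoutProdClass_of_isInitial _ initialIsInitial)
      b := (hI B).to _
      p := ψ'
      whiskerRight_comp_b := (hI A).hom_ext _ _
      b_comp_map_p := (hI B).hom_ext _ _ }
  have := hW.isStableUnderCobaseChange
  have := hW.isStableUnderTransfiniteComposition
  have := hW.isStableUnderRetracts
  have : IsStableUnderTransfiniteComposition.{0} W :=
    IsStableUnderTransfiniteComposition.shrink₀.{v} W
  -- The underlying morphism of the free module map is `X ◁ (j □ m)`. This membership keeps the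
  -- inclusions in the class and also places each stage in `W`.
  have hmem {N M : C} (m : N ⟶ M) (hm : (iteratedPushoutProdClass (C := C)).pushouts m) :
      (monoidAxiomClass C).pushouts (T.forget.map (T.free.map (pushoutProdMap j m))) :=
    monoidAxiomClass_pushouts_whiskerLeft_pushoutProdMap hl hr X.X j hj m hm
  obtain ⟨Q, i, p, b, h₁, h₂, h₃, h₄⟩ := s.exists_extension T.adj hact hP W
    (fun m hm ↦ MorphismProperty.pushouts_monotone
      monoidAxiomClass_le_iteratedPushoutProdClass _ (hmem m hm))
    (fun m hm ↦ MorphismProperty.pushouts_le _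
      (MorphismProperty.pushouts_monotone hW' _ (hmem m hm)))
  replace h₄ : W i.f := W.transfiniteCompositionsOfShape_le ℕ _ h₄
  have hip : i.f ≫ p.f = ψ.hom := congr_arg Monad.Algebra.Hom.f h₃
  have hi : (𝟙 X.X ▷ X.X ≫ μ[X.X]) ≫ i.f = X.X ◁ i.f ≫ MonObj.action Q := MonObj.action_comp i
  have hp : MonObj.action Q ≫ p.f = X.X ◁ p.f ≫ ψ.hom ▷ P.X ≫ μ[P.X] := MonObj.action_comp p
  rw [id_whiskerRight, Category.id_comp] at hi
  obtain ⟨φ, hφ, hφ'⟩ := EquivariantEnd.exists_section_of_equivariant hr ψ hβ desc ext (Q := Q.A)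
    (MonObj.action Q) (MonObj.one_action Q) (MonObj.mul_action Q) b h₁ p.f hp h₂ i.f hi hip
  exact W.of_comp_eq_of_section hφ hφ' h₄

end CategoryTheory

/-! ### Relative cell complexes of monoids. -/

namespace CategoryTheory

section

variable {C : Type*} [Category* C] {D : Type*} [Category* D] {F : C ⥤ D} {U : D ⥤ C}

lemma MorphismProperty.strictMap.exists_iso {J : MorphismProperty C} {X Y : D} {f : X ⟶ Y}
    (hf : J.strictMap F f) :
    ∃ (A B : C) (j : A ⟶ B), J j ∧
      Nonempty (CategoryTheory.Arrow.mk f ≅ CategoryTheory.Arrow.mk (F.map j)) := by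
  obtain ⟨h⟩ := hf
  exact ⟨_, _, _, h, ⟨Iso.refl _⟩⟩

/-- `F` preserves coproducts, so attaching a family of free cells is attaching one free cell on the
coproduct. -/
lemma MorphismProperty.exists_iso_of_coproducts_strictMap [HasCoproducts.{v} C]
    (J : MorphismProperty C) (adj : F ⊣ U) {X Y : D} {f : X ⟶ Y}
    (hf : coproducts.{v} (J.strictMap F) f) :
    ∃ (A B : C) (j : A ⟶ B), coproducts.{v} J j ∧
      Nonempty (CategoryTheory.Arrow.mk f ≅ CategoryTheory.Arrow.mk (F.map j)) := by
  rw [coproducts_iff] at hf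
  obtain ⟨K, ⟨X₁, X₂, c₁, c₂, h₁, h₂, f, hf⟩⟩ := hf
  choose A B j hj e using fun i ↦ (hf i).exists_iso
  replace e i := (e i).some
  have := adj.leftAdjoint_preservesColimits
  let G₁ := Discrete.functor (fun i ↦ A ⟨i⟩)
  let G₂ := Discrete.functor (fun i ↦ B ⟨i⟩)
  let g : G₁ ⟶ G₂ := Discrete.natTrans (fun i ↦ j i)
  let iso₁ : X₁ ≅ G₁ ⋙ F := Discrete.natIso (fun i ↦ CategoryTheory.Arrow.leftFunc.mapIso (e i))
  let iso₂ : X₂ ≅ G₂ ⋙ F := Discrete.natIso (fun i ↦ CategoryTheory.Arrow.rightFunc.mapIso (e i))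
  have comm (i : Discrete K) : iso₁.hom.app i ≫ F.map (g.app i) = f.app i ≫ iso₂.hom.app i :=
    CategoryTheory.Arrow.w (e i).hom
  let d₁' := F.mapCocone (colimit.cocone G₁)
  let d₂' := F.mapCocone (colimit.cocone G₂)
  let d₁ : IsColimit d₁' := isColimitOfPreserves F (colimit.isColimit G₁)
  let d₂ : IsColimit d₂' := isColimitOfPreserves F (colimit.isColimit G₂)
  refine ⟨colimit G₁, colimit G₂, colimMap g, ?_, ⟨CategoryTheory.Arrow.isoMk
    (IsColimit.coconePointsIsoOfNatIso h₁ d₁ iso₁)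
    (IsColimit.coconePointsIsoOfNatIso h₂ d₂ iso₂) ?_⟩⟩
  · exact colimitsOfShape_le_coproducts _ K _
      (colimitsOfShape.mk' _ _ _ _ (colimit.isColimit G₁) (colimit.isColimit G₂) g
        (fun i ↦ hj i) _ (fun i ↦ ι_colimMap g i))
  · refine h₁.hom_ext fun i ↦ ?_
    change c₁.ι.app i ≫ IsColimit.map h₁ d₁' iso₁.hom ≫ F.map (colimMap g) =
      c₁.ι.app i ≫ h₁.desc (Cocone.mk _ (f ≫ c₂.ι)) ≫ IsColimit.map h₂ d₂' iso₂.hom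
    rw [IsColimit.ι_map_assoc, IsColimit.fac_assoc]
    change iso₁.hom.app i ≫ F.map (colimit.ι G₁ i) ≫ F.map (colimMap g) =
      (f.app i ≫ c₂.ι.app i) ≫ IsColimit.map h₂ d₂' iso₂.hom
    rw [Category.assoc, IsColimit.ι_map, ← F.map_comp, ι_colimMap, F.map_comp, reassoc_of% comm i]
    rfl

lemma IsPushout.of_arrow_iso {S T S' T' X P : D} {a : S ⟶ X} {φ : S ⟶ T} {ψ : X ⟶ P} {b : T ⟶ P}
    {φ' : S' ⟶ T'} (sq : IsPushout a φ ψ b) (e : Arrow.mk φ ≅ Arrow.mk φ') :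
    IsPushout (e.inv.left ≫ a) φ' ψ (e.inv.right ≫ b) :=
  let e₁ : S ≅ S' := ⟨e.hom.left, e.inv.left, Arrow.hom_inv_id_left e, Arrow.hom_inv_id_left e.symm⟩
  let e₂ : T ≅ T' :=
    ⟨e.hom.right, e.inv.right, Arrow.hom_inv_id_right e, Arrow.hom_inv_id_right e.symm⟩
  sq.of_iso e₁ (Iso.refl _) e₂ (Iso.refl _)
    ((Category.comp_id a).trans (e₁.hom_inv_id_assoc a).symm) (Arrow.w e.hom).symm (by simp)
    ((Category.comp_id b).trans (e₂.hom_inv_id_assoc b).symm)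

section

variable (adj : F ⊣ U) {A B : C} {j : A ⟶ B} {X P : D} {a : F.obj A ⟶ X} {b : F.obj B ⟶ P}
  {ψ : X ⟶ P} (sq : IsPushout a (F.map j) ψ b)

include sq

/-- With the two lemmas that follow, this transposes the pushout property across the adjunction into
the hypotheses of `of_isPushout_mon`. -/
lemma IsPushout.homEquiv_comp_eq : j ≫ adj.homEquiv _ _ b = adj.homEquiv _ _ a ≫ U.map ψ := by
  rw [← adj.homEquiv_naturality_left, ← sq.w, adj.homEquiv_naturality_right]

lemma IsPushout.exists_desc_of_adjunction {M : D} (f : X ⟶ M) (g : B ⟶ U.obj M)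
    (h : j ≫ g = adj.homEquiv _ _ a ≫ U.map f) :
    ∃ θ : P ⟶ M, ψ ≫ θ = f ∧ adj.homEquiv _ _ b ≫ U.map θ = g := by
  have w : a ≫ f = F.map j ≫ (adj.homEquiv _ _).symm g := by
    apply (adj.homEquiv _ _).injective
    rw [adj.homEquiv_naturality_left, adj.homEquiv_naturality_right, Equiv.apply_symm_apply, h]
  refine ⟨sq.desc f _ w, sq.inl_desc _ _ _, ?_⟩
  rw [← adj.homEquiv_naturality_right, sq.inr_desc, Equiv.apply_symm_apply]

lemma IsPushout.hom_ext_of_adjunction {M : D} (f g : P ⟶ M) (h : ψ ≫ f = ψ ≫ g)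
    (h' : adj.homEquiv _ _ b ≫ U.map f = adj.homEquiv _ _ b ≫ U.map g) : f = g := by
  refine sq.hom_ext h ((adj.homEquiv _ _).injective ?_)
  rw [adj.homEquiv_naturality_right, adj.homEquiv_naturality_right, h']

end

lemma PreservesWellOrderContinuousOfShape.of_preservesColimitsOfShape (G : C ⥤ D)
    (J : Type v) [LinearOrder J] [OrderBot J]
    (hG : ∀ (K : Type v) [SmallCategory K] [IsFiltered K], PreservesColimitsOfShape K G) :
    PreservesWellOrderContinuousOfShape J G where
  preservesColimitsOfShape j hj := by
    have : Nonempty (Set.Iio j) := ⟨⟨⊥, hj.bot_lt⟩⟩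
    exact hG _

lemma MorphismProperty.retracts_transfiniteCompositions_le_inverseImage
    {W : MorphismProperty C} [IsStableUnderTransfiniteComposition.{v} W] [W.IsStableUnderRetracts]
    {U : D ⥤ C}
    (hU : ∀ (J : Type v) [SmallCategory J] [IsFiltered J], PreservesColimitsOfShape J U)
    {I : MorphismProperty D} (hI : I ≤ W.inverseImage U) :
    (transfiniteCompositions.{v} I).retracts ≤ W.inverseImage U := by
  rintro X Y f ⟨_, _, g, r, hg⟩
  refine W.of_retract (r.map U) ?_
  rw [transfiniteCompositions_iff] at hg
  obtain ⟨J, _, _, _, _, ⟨h⟩⟩ := hg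
  have := PreservesWellOrderContinuousOfShape.of_preservesColimitsOfShape U J hU
  have := hU J
  exact W.transfiniteCompositionsOfShape_le J _ ((h.ofLE hI).map (F := U)).mem

end

lemma MorphismProperty.IsWeaklySaturated.rlp_llp_strictMap_le {C : Type u} [Category.{v} C]
    [MonoidalCategory C] [ModelCategory C] (hC : IsCombinatorial C) [IsLocallyPresentable.{v} C]
    (hl : ∀ X : C, (tensorLeft X).IsLeftAdjoint) (hr : ∀ X : C, (tensorRight X).IsLeftAdjoint)
    {W : MorphismProperty C} (hW : W.IsWeaklySaturated) (hW' : monoidAxiomClass C ≤ W)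
    {F : C ⥤ Mon C} (adj : F ⊣ Mon.forget C) :
    ((trivialCofibrations C).strictMap F).rlp.llp ≤ W.inverseImage (Mon.forget C) := by
  obtain ⟨κ₀, _, _⟩ := IsLocallyPresentable.exists_cardinal.{v} C
  have := Mon.isLocallyPresentable hl hr adj
  obtain ⟨κ₁, _, _⟩ := IsLocallyPresentable.exists_cardinal.{v} (Mon C)
  obtain ⟨J, hJ⟩ := hC.exists_generatingTrivialCofibrations
  have := hJ.isSmall
  have := J.isSmall_strictMap F
  have := (J.strictMap F).hasSmallObjectArgument_of_isLocallyPresentable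
  have hJ' : (J.strictMap F).rlp = ((trivialCofibrations C).strictMap F).rlp := by
    rw [J.rlp_strictMap adj, MorphismProperty.rlp_strictMap _ adj, hJ.rlp_eq,
      MorphismProperty.rlp_eq_of_wfs (trivialCofibrations C) (fibrations C)]
  have hJ₂ : coproducts.{v} J ≤ trivialCofibrations C := by
    rw [← MorphismProperty.llp_eq_of_wfs (trivialCofibrations C) (fibrations C), ← hJ.rlp_eq]
    have : J ≤ J.rlp.llp := J.le_llp_rlp
    exact (coproducts_monotone this).trans (coproducts_le _)
  have := hW.isStableUnderTransfiniteComposition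
  have := hW.isStableUnderRetracts
  -- The class becomes the retracts of transfinite compositions of pushouts of coproducts of `F J`.
  -- As `U` preserves filtered colimits, a single pushout remains to be treated.
  rw [← hJ', llp_rlp_of_hasSmallObjectArgument]
  refine retracts_transfiniteCompositions_le_inverseImage
    (fun K _ _ ↦ Mon.preservesColimitsOfShape_forget_of_isFiltered hl hr) ?_
  rintro X P ψ ⟨S, T, φ, a, b, hφ, sq⟩
  obtain ⟨A, B, j, hj, ⟨e⟩⟩ := J.exists_iso_of_coproducts_strictMap adj hφ
  have sq' := sq.of_arrow_iso e
  exact hW.of_isPushout_mon hl hr hW' ψ (hJ₂ _ hj) (sq'.homEquiv_comp_eq adj)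
    (fun f g h ↦ sq'.exists_desc_of_adjunction adj f g h)
    (fun f g h h' ↦ sq'.hom_ext_of_adjunction adj f g h h')

end CategoryTheory

theorem mainTheorem12 (C : Type u) [Category.{v} C] [MonoidalCategory C] [ModelCategory C]
    (hC : IsCombinatorial C) (hM : IsMonoidalModelCategory C) (hA : MonoidAxiom C) :
    -- the free associative algebra functor exists, and for every choice of it (it is unique up
    -- to unique isomorphism) the monad of the free-forgetful adjunction is combinatorially
    -- admissible, and the category of associative algebras carries the transferred model structure
    (Mon.forget C).IsRightAdjoint ∧
    ∀ (F : C ⥤ Mon C) (adj : F ⊣ Mon.forget C),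
      IsCombinatoriallyAdmissible adj.toMonad ∧
      ∃ _ : ModelCategory (Mon C),
        IsTransferred (Mon.forget C) ∧ IsCombinatoriallyGeneratedBy F := by
  have hl := hM.isBiclosed.isLeftAdjoint_tensorLeft
  have hr := hM.isBiclosed.isLeftAdjoint_tensorRight
  have := hC.isLocallyPresentable
  obtain ⟨κ, _, _⟩ := IsLocallyPresentable.exists_cardinal.{v} C
  refine ⟨Mon.isRightAdjoint_forget hl hr, fun F adj ↦ ?_⟩
  have hMon := Mon.isLocallyPresentable hl hr adj
  have : HasFiniteLimits (Mon C) := ⟨fun _ _ _ ↦ inferInstance⟩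
  obtain ⟨m, h⟩ := exists_modelCategory_isTransferred adj hC
    -- The weak saturation is an intersection, so membership is proved for each weakly saturated
    -- class separately.
    (fun _ _ f hf ↦ hA _ fun _ hW hW' ↦ hW.rlp_llp_strictMap_le hC hl hr hW' adj f hf)
  refine ⟨?_, m, h, h.isCombinatoriallyGeneratedBy adj hC hMon⟩
  have := Mon.isEquivalence_comparison hl hr adj
  let e := (Monad.comparison adj).asEquivalence
  obtain ⟨m', h'⟩ := h.exists_of_equivalence e.symm
    (Functor.isoWhiskerLeft e.inverse (Monad.comparisonForget adj).symm ≪≫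
      (Functor.associator _ _ _).symm ≪≫ Functor.isoWhiskerRight e.counitIso adj.toMonad.forget ≪≫
      Functor.leftUnitor _)
  exact ⟨m', h', h'.isCombinatoriallyGeneratedBy adj.toMonad.adj hC e.isLocallyPresentable⟩
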